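/- Let $\rho<1$, $\alpha'>0$, and let $L$ be slowly varying at infinity. Let $q$ be a random variable with probability density $x^{-\rho}L(1/x)$ on $(0,1)$; given $q$, let $(\eta_j)_{j\ge1}$ be conditionally i.i.d. Bernoulli random variables with parameter $q$; and let $\mathcal X$ be a symmetric random variable independent of $(q,(\eta_j)_{j\ge 1})$. Assume that one of the following holds: (i) $0<\mathbb E\mathcal X^2<\infty$; in this case set $\alpha=2$ and $C_{\mathcal X}=\mathbb E\mathcal X^2$; (ii) $\mathbb P(|\mathcal X|>x)\sim C_{\mathcal X}x^{-\alpha}$ as $x\to\infty$ for some $\alpha\in(0,2)$ and $C_{\mathcal X}>0$. Assume further that $\beta:=\alpha/\alpha'-1+\rho\in(0,1)$. Let $(\mathcal X_i,q_i,(\eta_{i,j})_{j\ge1})$, $i\ge 1$, be i.i.d. copies of $(\mathcal X,q,(\eta_j)_{j\ge1})$, put $\tau_{i,j}=\sum_{k=1}^j\eta_{i,k}$, and let $(m_n)_{n\ge1}$ be a non-decreasing sequence of positive integers with $$\lim_{n\to\infty}\frac{m_nL(n)}{n^{1-\rho}}=\infty .$$ Define, for $t\in[0,1]$, $$\widehat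 S_n(t)=\sum_{j=1}^{\lfloor nt\rfloor}\sum_{i=1}^{m_n}\frac{\mathcal X_i}{q_i^{1/\alpha'}}(-1)^{\tau_{i,j}}\eta_{i,j},\qquad a_n=\Big(C_{\mathcal X}\frac{\Gamma(1-\beta)}{\beta}\,n^{\beta}m_nL(n)\Big)^{1/\alpha}.$$ Then, as $n\to\infty$, the finite-dimensional distributions of $(\widehat S_n(t)/a_n)_{t\in[0,1]}$ converge weakly to those of the Karlin stable process $(\zeta_{\alpha,\beta}(t))_{t\in[0,1]}$. Here $\zeta_{\alpha,\beta}$ is the symmetric $\alpha$-stable process whose finite-dimensional distributions are given, for $d\ge1$, $t_1,\dots,t_d\ge0$ and $\theta_1,\dots,\theta_d\in\mathbb R$, by $$\mathbb E\exp\Big(i\sum_{j=1}^d\theta_j\zeta_{\alpha,\beta}(t_j)\Big)=\exp\Big(-\frac{\beta}{\Gamma(1-\beta)\mathsf C_\alpha}\int_0^\infty\mathbb E\Big|\sum_{j=1}^d\theta_j\mathbf 1_{\{N(t_jq)\text{ odd}\}}\Big|^\alpha q^{-\beta-1}\,dq\Big),$$ where $N$ is a standard Poisson process, $\mathsf C_2=2$,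 and $\mathsf C_\alpha=\big(\int_0^\infty x^{-\alpha}\sin x\,dx\big)^{-1}$ (an improper integral) for $\alpha\in(0,2)$. -/

import Mathlib

open MeasureTheory ProbabilityTheory Filter Topology
open scoped NNReal ENNReal

noncomputable section

/-- `L` is slowly varying at infinity: measurable, eventually positive, and
`L (c x) / L x → 1` as `x → ∞` for every `c > 0`. -/
structure IsSlowlyVarying (L : ℝ → ℝ) : Prop where
  measurable : Measurable L
  eventually_pos : ∀ᶠ x in atTop, 0 < L x
  tendsto_div : ∀ c : ℝ, 0 < c → Tendsto (fun x => L (c * x) / L x) atTop (𝓝 1)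

/-! ### A standard Poisson process -/

/-- Sample space of the Poisson process: for each `k : ℕ` a number of points and a sequence of
candidate positions in the unit interval. -/
abbrev PoissonSpace : Type := ℕ → ℕ × (ℕ → unitInterval)

/-- The numbers of points are i.i.d. Poisson with mean `1`, the positions are i.i.d. uniform on
`[0,1]`, and everything is independent. -/
def poissonLaw : Measure PoissonSpace :=
  Measure.infinitePi (fun _ : ℕ =>
    (poissonMeasure 1).prod (Measure.infinitePi (fun _ : ℕ => (volume : Measure unitInterval))))

/-- The standard (unit-rate) Poisson process on `[0,∞)`: the interval `[k, k+1]` contains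
`(ω k).1` points, located at `k + (ω k).2 i` for `i < (ω k).1`, and `poissonCount s` is the number
of points in `[0, s]`. (Only intervals with `k ≤ s` can contribute.) -/
def poissonCount (s : ℝ) (ω : PoissonSpace) : ℕ :=
  ∑ k ∈ Finset.range (⌊s⌋₊ + 1),
    ((Finset.range (ω k).1).filter (fun i => (k : ℝ) + ((ω k).2 i : ℝ) ≤ s)).card

/-! ### Karlin stable processes -/

/-- The constant `C_α`: it is `2` for `α = 2`, and `(∫₀^∞ x^{-α} sin x dx)⁻¹` for `0 < α < 2`, the
integral being the improper integral `lim_{R → ∞} ∫₀^R` (it is not absolutely convergent for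
`α ≤ 1`). -/
def stableConst (α : ℝ) : ℝ :=
  if α = 2 then 2
  else (limUnder atTop (fun R : ℝ => ∫ x in (0 : ℝ)..R, x ^ (-α) * Real.sin x))⁻¹

/-- The exponent
`β / (Γ(1-β) C_α) ∫₀^∞ E |∑ⱼ θⱼ 1{N(tⱼ q) odd}|^α q^{-β-1} dq`, `N` a standard Poisson process. -/
def karlinExponent (α β : ℝ) {d : ℕ} (t : Fin d → ℝ≥0) (θ : Fin d → ℝ) : ℝ :=
  β / (Real.Gamma (1 - β) * stableConst α) *
    ∫ q in Set.Ioi (0 : ℝ),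
      (∫ ω, |∑ j, θ j * (if Odd (poissonCount ((t j : ℝ) * q) ω) then 1 else 0)| ^ α ∂poissonLaw)
        * q ^ (-β - 1)

/-- `ν` has the characteristic function of the finite-dimensional distribution of the Karlin
stable process `ζ_{α,β}` at the times `t`. -/
def IsKarlinFdd (α β : ℝ) {d : ℕ} (t : Fin d → ℝ≥0) (ν : Measure (Fin d → ℝ)) : Prop :=
  ∀ θ : Fin d → ℝ,
    ∫ x, Complex.exp (Complex.I * ((∑ j, θ j * x j : ℝ) : ℂ)) ∂ν
      = ((Real.exp (-karlinExponent α β t θ) : ℝ) : ℂ)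

/-- `ζ` is a Karlin stable process `ζ_{α,β}`, that is, a process indexed by `[0,∞)` with the
finite-dimensional distributions above. -/
structure IsKarlinStableProcess {Ω : Type*} [MeasurableSpace Ω] (α β : ℝ) (ζ : ℝ≥0 → Ω → ℝ)
    (P : Measure Ω) : Prop where
  aemeasurable : ∀ t, AEMeasurable (ζ t) P
  fdd : ∀ (d : ℕ) (t : Fin d → ℝ≥0), IsKarlinFdd α β t (P.map (fun ω j => ζ (t j) ω))

/-! ### The aggregated model -/

/-- Given `q`, the variables `η 0, η 1, …` are conditionally i.i.d. Bernoulli with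
parameter `q`. -/
structure IsCondIIDBernoulli {Ω : Type*} [MeasurableSpace Ω] (q : Ω → ℝ) (η : ℕ → Ω → ℕ)
    (P : Measure Ω) : Prop where
  measurable : ∀ j, Measurable (η j)
  condProb : ∀ (n : ℕ) (e : ℕ → ℕ), (∀ j, e j = 0 ∨ e j = 1) →
    P[Set.indicator {ω | ∀ j < n, η j ω = e j} (fun _ => (1 : ℝ)) |
        MeasurableSpace.comap q inferInstance]
      =ᵐ[P] fun ω => ∏ j ∈ Finset.range n, (if e j = 1 then q ω else 1 - q ω)

/-- The law on `ℝ` with density `x^{-ρ} L(1/x)` on `(0,1)`. -/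
def parameterLaw (ρ : ℝ) (L : ℝ → ℝ) : Measure ℝ :=
  (volume.restrict (Set.Ioo (0 : ℝ) 1)).withDensity
    (fun x => ENNReal.ofReal (x ^ (-ρ) * L (1 / x)))

/-- The law of the triple `(𝒳, q, (η_j)_j)` : `𝒳` is symmetric and independent of `(q, (η_j)_j)`,
`q` has density `x^{-ρ} L(1/x)` on `(0,1)`, and given `q` the `η_j` are i.i.d. Bernoulli(`q`). -/
structure IsBaseModel {Ω : Type*} [MeasurableSpace Ω] (ρ : ℝ) (L : ℝ → ℝ)
    (X q : Ω → ℝ) (η : ℕ → Ω → ℕ) (P : Measure Ω) : Prop where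
  measurable_X : Measurable X
  measurable_q : Measurable q
  symmetric : IdentDistrib X (fun ω => -X ω) P P
  law_q : P.map q = parameterLaw ρ L
  bernoulli : IsCondIIDBernoulli q η P
  indep : IndepFun X (fun ω => (q ω, fun j => η j ω)) P

/-- The model variable with (zero-based) time index `j`:
`X / q^{1/α'} * (-1)^{τ} * η_j`, where `τ = η_0 + ⋯ + η_j` counts up to and including `η_j`. -/
def modelVar {Ω : Type*} (α' : ℝ) (X q : Ω → ℝ) (η : ℕ → Ω → ℕ) (j : ℕ) (ω : Ω) : ℝ :=
  X ω / q ω ^ (1 / α') * (-1) ^ (∑ k ∈ Finset.range (j + 1), η k ω) * (η j ω : ℝ)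

/-- The partial-sum process at time `t` of the aggregation of `M` copies, at time scale `n`:
the sum of the first `⌊n t⌋` terms of the series `∑_{i < M} (modelVar of the i-th copy)`. -/
def aggregatedSum {Ω : Type*} (α' : ℝ) (X q : ℕ → Ω → ℝ) (η : ℕ → ℕ → Ω → ℕ)
    (M n : ℕ) (t : ℝ≥0) (ω : Ω) : ℝ :=
  ∑ j ∈ Finset.range ⌊(n : ℝ≥0) * t⌋₊, ∑ i ∈ Finset.range M, modelVar α' (X i) (q i) (η i) j ω

/-- The normalization `(C Γ(1-β)/β · n^β M L(n))^{1/α}`. -/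
def normalization (α β C : ℝ) (L : ℝ → ℝ) (M n : ℕ) : ℝ :=
  (C * (Real.Gamma (1 - β) / β) * ((n : ℝ) ^ β * M * L n)) ^ (1 / α)

/-- Either `E X² < ∞`, with `α = 2` and `C = E X²` (nonzero), or `P(|X| > x) ∼ C x^{-α}` as
`x → ∞` with `0 < α < 2` and `C > 0`. -/
def TailCondition {Ω : Type*} [MeasurableSpace Ω] (α C : ℝ) (X : Ω → ℝ) (P : Measure Ω) : Prop :=
  (α = 2 ∧ Integrable (fun ω => X ω ^ 2) P ∧ C = ∫ ω, X ω ^ 2 ∂P ∧ 0 < C) ∨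
  (0 < α ∧ α < 2 ∧ 0 < C ∧
    Asymptotics.IsEquivalent atTop (fun x : ℝ => P.real {ω | x < |X ω|})
      (fun x : ℝ => C * x ^ (-α)))

end

/-! Write `h s = E(1 - cos (s 𝒳))`. Since the copies are i.i.d. and `𝒳` is symmetric, the
characteristic function at `θ` is `(1 - x_n)^{m_n}` with `x_n` real, so it suffices that `m_n → ∞`
and that `m_n x_n` tends to the Karlin exponent (`tendsto_one_sub_pow_exp`).

The alternating sum telescopes: up to time `N` it equals `-1` if the number of successes is odd, and
`0` otherwise (`sum_neg_one_pow_mul`). Hence `x_n` is the integral over the law of `q` of the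
Bernoulli(`q`) expectation of `h (q^{-1/α'} a_n^{-1} W)`, where `W` sums the `θ_k` over the times
with odd count (`IsBaseModel.integral_cexp`).

Substitute `q = u/n`. Three things happen for fixed `u`. The argument of `h` tends to zero, by the
growth condition on `m_n`, so `h s ∼ C |s|^α / C_α` applies (`TailCondition.tendsto_symbol`). The
parities of the Bernoulli counts converge in law to those of a Poisson process
(`tendsto_bernoulliExp_oddSet`); this is checked on Walsh functions, whose expectations are explicit
on both sides. The powers of `u` combine to `u^{-β-1}`, and `a_n` cancels all powers of `n`.
Domination comes from Potter's bound and from the probability of at least one success, at most `min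
1 u`; the resulting function is integrable because `0 < β < 1`
(`tendsto_integral_small_parameters`). Values of `q` away from zero contribute `O(1 / (n^β L(n)))`,
which vanishes (`tendsto_mul_integral_bernoulliExp`).

Lévy's continuity theorem concludes. The limit exponent is continuous at `θ = 0`, so the
approximating laws are tight and the limit law exists without being assumed. -/

/-! ### Slowly varying functions: local uniformity and Potter's bound. -/

/-- Local uniformity in the uniform convergence theorem for slowly varying functions, in additive
form. -/
lemma exists_forall_abs_sub_le_of_tendsto_add_sub {h : ℝ → ℝ} (hm : Measurable h)
    (ht : ∀ u, Tendsto (fun x => h (x + u) - h x) atTop (𝓝 0)) {ε : ℝ} (hε : 0 < ε) :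
    ∃ X, ∀ x, X ≤ x → ∀ u, 0 ≤ u → u ≤ 1 → |h (x + u) - h x| ≤ ε := by
  -- Truncation at 1 makes the increments bounded, so pointwise convergence gives convergence of
  -- their integrals.
  set D : ℝ → ℝ → ℝ := fun x v => min 1 |h (x + v) - h x| with hD
  have hDm : ∀ x, Measurable (D x) := fun x => by fun_prop
  have hD0 : ∀ x v, 0 ≤ D x v := fun x v => le_min zero_le_one (abs_nonneg _)
  have hD1 : ∀ x v, D x v ≤ 1 := fun x v => min_le_left _ _
  have hDint : ∀ x a b, IntervalIntegrable (D x) volume a b := fun x a b => by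
    refine (intervalIntegrable_const (c := (1 : ℝ))).mono_fun
      (hDm x).aestronglyMeasurable (Eventually.of_forall fun v => ?_)
    simp only [Real.norm_eq_abs, abs_one]
    rw [abs_of_nonneg (hD0 x v)]
    exact hD1 x v
  have hI : Tendsto (fun x => ∫ v in (0 : ℝ)..2, D x v) atTop (𝓝 (∫ v in (0 : ℝ)..2, (0 : ℝ))) := by
    refine intervalIntegral.tendsto_integral_filter_of_dominated_convergence (fun _ => 1)
      (Eventually.of_forall fun x => (hDm x).aestronglyMeasurable) ?_ intervalIntegrable_const ?_
    · refine Eventually.of_forall fun x => Eventually.of_forall fun v _ => ?_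
      rw [Real.norm_eq_abs, abs_of_nonneg (hD0 x v)]
      exact hD1 x v
    · refine Eventually.of_forall fun v _ => ?_
      have h1 : Tendsto (fun x => min 1 |h (x + v) - h x|) atTop (𝓝 (min 1 |(0 : ℝ)|)) :=
        tendsto_const_nhds.min (ht v).abs
      simpa using h1
  simp only [intervalIntegral.integral_zero] at hI
  have hη : 0 < min 1 ε / 2 := by positivity
  obtain ⟨X, hX⟩ := eventually_atTop.1 (hI.eventually (gt_mem_nhds hη))
  refine ⟨X, fun x hx u hu0 hu1 => ?_⟩
  -- Compare both points with a third one, `x + v`, and average over `v ∈ [1, 2]`. As `v` and `v -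
  -- u` stay in `[0, 2]`, each average is below `min 1 ε / 2`.
  have key : min 1 |h (x + u) - h x| < min 1 ε := by
    have e1 : ∀ v ∈ Set.Icc (1 : ℝ) 2, min 1 |h (x + u) - h x| ≤ D x v + D (x + u) (v - u) := by
      intro v _
      have h2 : x + u + (v - u) = x + v := by ring
      simp only [hD, h2]
      rcases le_total 1 |h (x + v) - h x| with h3 | h3
      · rw [min_eq_left h3]
        have := le_min zero_le_one (abs_nonneg (h (x + v) - h (x + u)))
        linarith [min_le_left 1 |h (x + u) - h x|]
      rcases le_total 1 |h (x + v) - h (x + u)| with h4 | h4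
      · rw [min_eq_left h4]
        have := le_min zero_le_one (abs_nonneg (h (x + v) - h x))
        linarith [min_le_left 1 |h (x + u) - h x|]
      rw [min_eq_right h3, min_eq_right h4]
      refine (min_le_right _ _).trans ?_
      have := abs_sub (h (x + v) - h x) (h (x + v) - h (x + u))
      have e : h (x + v) - h x - (h (x + v) - h (x + u)) = h (x + u) - h x := by ring
      rwa [e] at this
    have e2 : ∫ _ in (1 : ℝ)..2, min 1 |h (x + u) - h x|
        ≤ ∫ v in (1 : ℝ)..2, (D x v + D (x + u) (v - u)) :=
      intervalIntegral.integral_mono_on (by norm_num) intervalIntegrable_const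
        ((hDint _ _ _).add (by simpa using (hDint (x + u) (1 - u) (2 - u)).comp_sub_right u)) e1
    rw [intervalIntegral.integral_add (hDint _ _ _)
      (by simpa using (hDint (x + u) (1 - u) (2 - u)).comp_sub_right u),
      intervalIntegral.integral_comp_sub_right (fun v => D (x + u) v)] at e2
    simp only [intervalIntegral.integral_const, smul_eq_mul] at e2
    have e3 : ∫ v in (1 : ℝ)..2, D x v ≤ ∫ v in (0 : ℝ)..2, D x v :=
      intervalIntegral.integral_mono_interval (by norm_num) (by norm_num) le_rfl
        (Eventually.of_forall (hD0 x)) (hDint _ _ _)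
    have e4 : ∫ v in (1 - u)..(2 - u), D (x + u) v ≤ ∫ v in (0 : ℝ)..2, D (x + u) v :=
      intervalIntegral.integral_mono_interval (by linarith) (by linarith) (by linarith)
        (Eventually.of_forall (hD0 _)) (hDint _ _ _)
    have e5 := hX x hx
    have e6 := hX (x + u) (by linarith)
    linarith
  have h1 : min 1 ε ≤ ε := min_le_right _ _
  have h2 : min 1 ε ≤ 1 := min_le_left _ _
  rcases min_lt_iff.1 (key) with h3 | h3 <;> linarith

/-- Chain `⌊|y - x|⌋` unit steps and one fractional step. The resulting linear growth of a logarithm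
becomes the power in Potter's bound. -/
lemma abs_sub_le_of_forall_unit_step {h : ℝ → ℝ} {ε X : ℝ}
    (hX : ∀ x, X ≤ x → ∀ u, 0 ≤ u → u ≤ 1 → |h (x + u) - h x| ≤ ε) {x y : ℝ} (hx : X ≤ x)
    (hy : X ≤ y) : |h y - h x| ≤ ε * (|y - x| + 1) := by
  have hε : 0 ≤ ε := (abs_nonneg _).trans (hX X le_rfl 0 le_rfl zero_le_one)
  have step : ∀ n : ℕ, ∀ x, X ≤ x → |h (x + n) - h x| ≤ ε * n := by
    intro n
    induction n with
    | zero => intro x _; simp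
    | succ n ih =>
      intro x hx
      have h1 := hX (x + n) (by have : (0 : ℝ) ≤ n := n.cast_nonneg
                                linarith) 1 zero_le_one le_rfl
      have h2 := ih x hx
      push_cast
      rw [← add_assoc]
      have h3 := abs_sub_le (h (x + n + 1)) (h (x + n)) (h x)
      linarith
  have main : ∀ x y, X ≤ x → x ≤ y → |h y - h x| ≤ ε * (|y - x| + 1) := by
    intro x y hx hxy
    have h0 : 0 ≤ y - x := sub_nonneg.2 hxy
    set n := ⌊y - x⌋₊
    have h1 : (n : ℝ) ≤ y - x := Nat.floor_le h0
    have h2 : y - x < n + 1 := Nat.lt_floor_add_one _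
    have h3 := hX (x + n) (by have : (0 : ℝ) ≤ n := n.cast_nonneg
                              linarith) (y - x - n) (by linarith) (by linarith)
    rw [show x + n + (y - x - n) = y by ring] at h3
    have h4 := step n x hx
    have h5 := abs_sub_le (h y) (h (x + n)) (h x)
    rw [abs_of_nonneg h0]
    nlinarith
  rcases le_total x y with h1 | h1
  · exact main x y hx h1
  · rw [abs_sub_comm, abs_sub_comm y x]
    exact main y x hy h1

/-- Potter's bound. -/
lemma IsSlowlyVarying.exists_potter {L : ℝ → ℝ} (hL : IsSlowlyVarying L) {δ : ℝ} (hδ : 0 < δ) :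
    ∃ x₀ : ℝ, 1 ≤ x₀ ∧ (∀ x, x₀ ≤ x → 0 < L x) ∧ ∀ x y, x₀ ≤ x → x₀ ≤ y →
      L y / L x ≤ Real.exp δ * ((y / x) ^ δ + (y / x) ^ (-δ)) := by
  obtain ⟨x₁, hx₁⟩ := eventually_atTop.1 hL.eventually_pos
  -- In logarithmic coordinates slow variation reads `h (x + u) - h x → 0`.
  set h : ℝ → ℝ := fun x => Real.log (L (Real.exp x)) with hh
  have hm : Measurable h :=
    Real.measurable_log.comp (hL.measurable.comp Real.measurable_exp)
  have ht : ∀ u, Tendsto (fun x => h (x + u) - h x) atTop (𝓝 0) := by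
    intro u
    have h1 := ((hL.tendsto_div (Real.exp u) (Real.exp_pos u)).comp Real.tendsto_exp_atTop).log
      one_ne_zero
    rw [Real.log_one] at h1
    refine h1.congr' ?_
    have e1 : ∀ᶠ x in atTop, 0 < L (Real.exp x) :=
      Real.tendsto_exp_atTop.eventually hL.eventually_pos
    have e2 : ∀ᶠ x in atTop, 0 < L (Real.exp (x + u)) :=
      (Real.tendsto_exp_atTop.comp (tendsto_atTop_add_const_right _ u tendsto_id)).eventually
        hL.eventually_pos
    filter_upwards [e1, e2] with x p1 p2
    simp only [Function.comp, hh]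
    rw [← Real.exp_add, add_comm u x, Real.log_div p2.ne' p1.ne']
  obtain ⟨X, hX⟩ := exists_forall_abs_sub_le_of_tendsto_add_sub hm ht hδ
  refine ⟨max 1 (max x₁ (Real.exp X)), le_max_left _ _, fun x hx => hx₁ x
    ((le_max_left _ _).trans ((le_max_right _ _).trans hx)), fun x y hx hy => ?_⟩
  have hx0 : 0 < x := lt_of_lt_of_le one_pos ((le_max_left _ _).trans hx)
  have hy0 : 0 < y := lt_of_lt_of_le one_pos ((le_max_left _ _).trans hy)
  have hLx := hx₁ x ((le_max_left _ _).trans ((le_max_right _ _).trans hx))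
  have hLy := hx₁ y ((le_max_left _ _).trans ((le_max_right _ _).trans hy))
  have b1 : X ≤ Real.log x :=
    (Real.le_log_iff_exp_le hx0).2 ((le_max_right _ _).trans ((le_max_right _ _).trans hx))
  have b2 : X ≤ Real.log y :=
    (Real.le_log_iff_exp_le hy0).2 ((le_max_right _ _).trans ((le_max_right _ _).trans hy))
  have h1 := abs_sub_le_of_forall_unit_step hX b1 b2
  simp only [hh, Real.exp_log hx0, Real.exp_log hy0] at h1
  rw [← Real.log_div hLy.ne' hLx.ne', ← Real.log_div hy0.ne' hx0.ne'] at h1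
  have h2 : Real.log (L y / L x) ≤ δ * |Real.log (y / x)| + δ := by
    linarith [le_abs_self (Real.log (L y / L x))]
  have hyx : 0 < y / x := div_pos hy0 hx0
  calc L y / L x = Real.exp (Real.log (L y / L x)) := (Real.exp_log (div_pos hLy hLx)).symm
    _ ≤ Real.exp (δ * |Real.log (y / x)| + δ) := Real.exp_le_exp.2 h2
    _ = Real.exp δ * Real.exp (δ * |Real.log (y / x)|) := by rw [add_comm, Real.exp_add]
    _ ≤ _ := by
      gcongr
      -- The exponential of `δ |log (y / x)|` is one of the two powers, depending on the sign of the
      -- logarithm.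
      rw [Real.rpow_def_of_pos hyx, Real.rpow_def_of_pos hyx]
      rcases abs_cases (Real.log (y / x)) with ⟨h3, _⟩ | ⟨h3, _⟩
      · rw [h3, mul_comm]
        linarith [Real.exp_pos (Real.log (y / x) * -δ)]
      · rw [h3, show δ * -Real.log (y / x) = Real.log (y / x) * -δ by ring]
        linarith [Real.exp_pos (Real.log (y / x) * δ)]

/-- A positive power times a slowly varying function tends to infinity. -/
lemma IsSlowlyVarying.tendsto_rpow_mul_atTop {L : ℝ → ℝ} (hL : IsSlowlyVarying L) {β : ℝ}
    (hβ : 0 < β) : Tendsto (fun x => x ^ β * L x) atTop atTop := by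
  obtain ⟨x₀, h1, hpos, hP⟩ := hL.exists_potter (half_pos hβ)
  have hx₀ : 0 < x₀ := by linarith
  have h2 : Tendsto (fun x : ℝ => x ^ (β / 2)) atTop atTop := tendsto_rpow_atTop (half_pos hβ)
  set c := L x₀ / (Real.exp (β / 2) * (2 * x₀ ^ (-(β / 2))))
  have hc : 0 < c := by have := hpos x₀ le_rfl; positivity
  refine tendsto_atTop_mono' _ ?_ (h2.const_mul_atTop hc)
  filter_upwards [eventually_ge_atTop x₀] with x hx
  have hx0 : 0 < x := by linarith
  -- Potter's bound with the fixed point `x₀` in the numerator bounds `L x` from below by a multiple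
  -- of `x ^ (-β / 2)`.
  have h3 := hP x x₀ hx le_rfl
  have h4 : (x₀ / x) ^ (β / 2) ≤ (x₀ / x) ^ (-(β / 2)) :=
    Real.rpow_le_rpow_of_exponent_ge (by positivity) ((div_le_one hx0).2 hx) (by linarith)
  have h5 : (x₀ / x) ^ (-(β / 2)) = x₀ ^ (-(β / 2)) * x ^ (β / 2) := by
    rw [Real.div_rpow hx₀.le hx0.le, Real.rpow_neg hx0.le, div_inv_eq_mul]
  rw [h5] at h3 h4
  have h6 : L x₀ ≤ Real.exp (β / 2) * (2 * x₀ ^ (-(β / 2))) * x ^ (β / 2) * L x := by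
    rw [← div_le_iff₀ (hpos x hx)]
    refine h3.trans ?_
    rw [mul_assoc]
    gcongr
    linarith
  have h7 : c ≤ x ^ (β / 2) * L x := by
    simp only [c]
    rw [div_le_iff₀ (by positivity)]
    linarith
  have h8 : x ^ β = x ^ (β / 2) * x ^ (β / 2) := by rw [← Real.rpow_add hx0]; ring_nf
  rw [h8]
  have := Real.rpow_pos_of_pos hx0 (β / 2)
  nlinarith

/-- A slowly varying function is negligible with respect to positive powers. -/
lemma IsSlowlyVarying.tendsto_div_rpow_zero {L : ℝ → ℝ} (hL : IsSlowlyVarying L) {γ : ℝ}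
    (hγ : 0 < γ) : Tendsto (fun x => L x / x ^ γ) atTop (𝓝 0) := by
  obtain ⟨x₀, h1, hpos, hP⟩ := hL.exists_potter (half_pos hγ)
  have hx₀ : 0 < x₀ := by linarith
  set c := L x₀ * (Real.exp (γ / 2) * (2 * x₀ ^ (-(γ / 2))))
  have h2 : Tendsto (fun x : ℝ => c * x ^ (-(γ / 2))) atTop (𝓝 (c * 0)) :=
    (tendsto_rpow_neg_atTop (half_pos hγ)).const_mul c
  rw [mul_zero] at h2
  refine squeeze_zero' ?_ ?_ h2
  · filter_upwards [eventually_ge_atTop x₀] with x hx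
    have := hpos x hx
    have hx0 : 0 < x := by linarith
    positivity
  · filter_upwards [eventually_ge_atTop x₀] with x hx
    have hx0 : 0 < x := by linarith
    have hLx := hpos x₀ le_rfl
    have h3 := hP x₀ x le_rfl hx
    have h4 : (x / x₀) ^ (-(γ / 2)) ≤ (x / x₀) ^ (γ / 2) :=
      Real.rpow_le_rpow_of_exponent_le ((one_le_div hx₀).2 hx) (by linarith)
    have h5 : (x / x₀) ^ (γ / 2) = x₀ ^ (-(γ / 2)) * x ^ (γ / 2) := by
      rw [Real.div_rpow hx0.le hx₀.le, Real.rpow_neg hx₀.le, div_eq_mul_inv, mul_comm]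
    rw [h5] at h3 h4
    have h6 : L x ≤ c * x ^ (γ / 2) := by
      rw [div_le_iff₀ hLx] at h3
      refine h3.trans ?_
      have : Real.exp (γ / 2) * (x₀ ^ (-(γ / 2)) * x ^ (γ / 2) + (x / x₀) ^ (-(γ / 2))) * L x₀ ≤
          Real.exp (γ / 2) * (x₀ ^ (-(γ / 2)) * x ^ (γ / 2) + x₀ ^ (-(γ / 2)) * x ^ (γ / 2)) * L x₀ := by
        gcongr
      refine this.trans (le_of_eq ?_)
      simp only [c]; ring
    rw [div_le_iff₀ (by positivity), mul_assoc, ← Real.rpow_add hx0]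
    ring_nf at h6 ⊢
    exact h6

/-! ### Behaviour at zero of `s ↦ E(1 - cos (s X))`. -/

/-- Comparing two levels `R`, `R'` through a common `f s` shows that `J` is Cauchy, and `f` must
then share its limit. It yields the existence of the improper integral in `stableConst` together
with the asymptotics. -/
lemma exists_tendsto_of_forall_eventually_abs_sub_le {ι : Type*} {l : Filter ι} [l.NeBot]
    {f : ι → ℝ} {J e : ℝ → ℝ} (he : Tendsto e atTop (𝓝 0))
    (hf : ∀ R, 0 < R → ∀ ε, 0 < ε → ∀ᶠ s in l, |f s - J R| ≤ e R + ε) :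
    ∃ a, Tendsto J atTop (𝓝 a) ∧ Tendsto f l (𝓝 a) := by
  have h1 : ∀ R R', 0 < R → 0 < R' → |J R - J R'| ≤ e R + e R' := by
    intro R R' hR hR'
    refine le_of_forall_pos_le_add fun ε hε => ?_
    obtain ⟨s, h1, h2⟩ := ((hf R hR _ (half_pos hε)).and (hf R' hR' _ (half_pos hε))).exists
    have := abs_sub_le (J R) (f s) (J R')
    rw [abs_sub_comm] at h1
    linarith
  have hc : Cauchy (map J atTop) := by
    rw [Metric.cauchy_iff]
    refine ⟨inferInstance, fun ε hε => ?_⟩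
    obtain ⟨N, hN⟩ := eventually_atTop.1 ((he.eventually (gt_mem_nhds (half_pos hε))).and
      (eventually_gt_atTop (0 : ℝ)))
    refine ⟨J '' Set.Ici N, image_mem_map (mem_atTop N), ?_⟩
    rintro _ ⟨x, hx, rfl⟩ _ ⟨y, hy, rfl⟩
    rw [Real.dist_eq]
    have := h1 x y (hN x hx).2 (hN y hy).2
    linarith [(hN x hx).1, (hN y hy).1]
  obtain ⟨a, ha⟩ := CompleteSpace.complete hc
  have ha : Tendsto J atTop (𝓝 a) := ha
  refine ⟨a, ha, ?_⟩
  have h2 : ∀ R, 0 < R → |J R - a| ≤ e R := by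
    intro R hR
    have t1 : Tendsto (fun R' => |J R - J R'|) atTop (𝓝 |J R - a|) :=
      (tendsto_const_nhds.sub ha).abs
    have t2 : Tendsto (fun R' => e R + e R') atTop (𝓝 (e R + 0)) := tendsto_const_nhds.add he
    rw [add_zero] at t2
    refine le_of_tendsto_of_tendsto t1 t2 ?_
    filter_upwards [eventually_gt_atTop 0] with R' hR'
    exact h1 R R' hR hR'
  rw [Metric.tendsto_nhds]
  intro ε hε
  obtain ⟨R, h3, hR⟩ := ((he.eventually (gt_mem_nhds (show 0 < ε / 4 by positivity))).and
    (eventually_gt_atTop (0 : ℝ))).exists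
  filter_upwards [hf R hR (ε / 4) (by positivity)] with s hs
  rw [Real.dist_eq]
  have := abs_sub_le (f s) (J R) a
  linarith [h2 R hR]

section Symbol

variable {Ω : Type*} [MeasurableSpace Ω] {P : Measure Ω} {X : Ω → ℝ}

lemma integrable_one_sub_cos [IsProbabilityMeasure P] (hX : Measurable X) (s : ℝ) :
    Integrable (fun ω => 1 - Real.cos (s * X ω)) P := by
  refine Integrable.of_bound (C := 2) (by fun_prop) (Eventually.of_forall fun ω => ?_)
  rw [Real.norm_eq_abs, abs_le]
  constructor <;> linarith [Real.cos_le_one (s * X ω), Real.neg_one_le_cos (s * X ω)]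

lemma integral_one_sub_cos_nonneg (s : ℝ) : 0 ≤ ∫ ω, (1 - Real.cos (s * X ω)) ∂P :=
  integral_nonneg fun _ => sub_nonneg.2 (Real.cos_le_one _)

lemma integral_one_sub_cos_le_two [IsProbabilityMeasure P] (s : ℝ) : ∫ ω, (1 - Real.cos (s * X ω)) ∂P ≤ 2 := by
  have h := integral_mono_of_nonneg (μ := P) (f := fun ω => 1 - Real.cos (s * X ω))
    (g := fun _ => (2 : ℝ)) (Eventually.of_forall fun ω => sub_nonneg.2 (Real.cos_le_one _))
    (integrable_const _)
    (Eventually.of_forall fun ω => by linarith [Real.neg_one_le_cos (s * X ω)])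
  simpa using h

lemma integral_one_sub_cos_abs (s : ℝ) :
    ∫ ω, (1 - Real.cos (|s| * X ω)) ∂P = ∫ ω, (1 - Real.cos (s * X ω)) ∂P := by
  congr 1 with ω
  rcases abs_choice s with h | h <;> simp [h]

/-- Dominated convergence, using `1 - cos y ≤ y² / 2`. The quotient is rewritten as `(X² / 2) sinc²
(s X / 2)` to read off its limit by continuity. -/
lemma tendsto_integral_one_sub_cos_div_sq (hX : Measurable X)
    (hX2 : Integrable (fun ω => X ω ^ 2) P) :
    Tendsto (fun s : ℝ => (∫ ω, (1 - Real.cos (s * X ω)) ∂P) / s ^ 2) (𝓝[>] 0)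
      (𝓝 ((∫ ω, X ω ^ 2 ∂P) * 2⁻¹)) := by
  have h1 : (∫ ω, X ω ^ 2 ∂P) * 2⁻¹ = ∫ ω, X ω ^ 2 * 2⁻¹ ∂P := (integral_mul_const _ _).symm
  rw [h1]
  simp_rw [← integral_div]
  refine tendsto_integral_filter_of_dominated_convergence (fun ω => X ω ^ 2 * 2⁻¹)
    (Eventually.of_forall fun s => by fun_prop) ?_ (hX2.mul_const _) ?_
  · filter_upwards [self_mem_nhdsWithin] with s hs
    refine Eventually.of_forall fun ω => ?_
    have hs : 0 < s := hs
    rw [Real.norm_eq_abs, abs_of_nonneg (div_nonneg (sub_nonneg.2 (Real.cos_le_one _)) (sq_nonneg _)),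
      div_le_iff₀ (by positivity)]
    have := Real.one_sub_sq_div_two_le_cos (x := s * X ω)
    nlinarith
  · refine Eventually.of_forall fun ω => ?_
    rcases eq_or_ne (X ω) 0 with h0 | h0
    · simp [h0]
    have h2 : Tendsto (fun s : ℝ => X ω ^ 2 / 2 * (Real.sinc (s * X ω / 2)) ^ 2) (𝓝[>] 0)
        (𝓝 (X ω ^ 2 * 2⁻¹)) := by
      have : Continuous fun s : ℝ => X ω ^ 2 / 2 * (Real.sinc (s * X ω / 2)) ^ 2 := by
        have := Real.continuous_sinc
        fun_prop
      have h3 := this.tendsto 0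
      simp only [zero_mul, zero_div, Real.sinc_zero] at h3
      refine (h3.mono_left nhdsWithin_le_nhds).trans (le_of_eq ?_)
      congr 1; ring
    refine h2.congr' ?_
    filter_upwards [self_mem_nhdsWithin] with s hs
    have hs : 0 < s := hs
    have e : s * X ω / 2 ≠ 0 := by positivity
    rw [Real.sinc_of_ne_zero e]
    have h4 : Real.cos (s * X ω) = 1 - 2 * Real.sin (s * X ω / 2) ^ 2 := by
      have := Real.cos_sq' (s * X ω / 2)
      have h5 := Real.cos_two_mul (s * X ω / 2)
      rw [show 2 * (s * X ω / 2) = s * X ω by ring] at h5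
      rw [h5, this]; ring
    rw [h4]
    field_simp
    ring

/-- Truncated Fourier representation of `E (1 - cos (s X))` in terms of the tail of `|X|`. -/
lemma abs_integral_one_sub_cos_sub_le [IsProbabilityMeasure P] (hX : Measurable X) {s R : ℝ} (hs : 0 < s) (hR : 0 < R) :
    |∫ ω, (1 - Real.cos (s * X ω)) ∂P - ∫ u in (0 : ℝ)..R, Real.sin u * P.real {ω | u / s < |X ω|}|
      ≤ 2 * P.real {ω | R / s < |X ω|} := by
  have hY : ∀ ω u, u / s < |X ω| ↔ u < s * |X ω| := fun ω u => by
    rw [div_lt_iff₀ hs, mul_comm]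
  have hms : ∀ u, MeasurableSet {ω | u / s < |X ω|} := fun u =>
    measurableSet_lt measurable_const (by fun_prop)
  have hjoint : MeasurableSet {p : Ω × ℝ | p.2 / s < |X p.1|} :=
    measurableSet_lt (by fun_prop) (by fun_prop)
  have hint : Integrable (fun p : Ω × ℝ => {p : Ω × ℝ | p.2 / s < |X p.1|}.indicator
      (fun p => Real.sin p.2) p) (P.prod (volume.restrict (Set.Ioc 0 R))) := by
    refine Integrable.of_bound (C := 1)
      ((Measurable.indicator (by fun_prop) hjoint).aestronglyMeasurable)
      (Eventually.of_forall fun p => ?_)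
    by_cases hp : p ∈ {p : Ω × ℝ | p.2 / s < |X p.1|}
    · rw [Set.indicator_of_mem hp]; exact Real.abs_sin_le_one _
    · rw [Set.indicator_of_notMem hp]; simp
  -- By Fubini, integrating `sin` up to `min (s|X|) R` gives `1 - cos` of that minimum. It differs
  -- from `1 - cos (s X)` only when `s|X| > R`, and then by at most 2.
  have e1 : ∫ u in (0 : ℝ)..R, Real.sin u * P.real {ω | u / s < |X ω|}
      = ∫ ω, (1 - Real.cos (min (s * |X ω|) R)) ∂P := by
    rw [intervalIntegral.integral_of_le hR.le]
    have e2 : ∀ u, Real.sin u * P.real {ω | u / s < |X ω|} =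
        ∫ ω, {p : Ω × ℝ | p.2 / s < |X p.1|}.indicator (fun p => Real.sin p.2) (ω, u) ∂P := by
      intro u
      have : (fun ω => {p : Ω × ℝ | p.2 / s < |X p.1|}.indicator (fun p => Real.sin p.2) (ω, u))
          = {ω | u / s < |X ω|}.indicator fun _ => Real.sin u := by
        ext ω; simp [Set.indicator]
      rw [this, integral_indicator_const _ (hms u), smul_eq_mul, mul_comm]
    simp_rw [e2]
    rw [← integral_integral_swap hint]
    congr 1 with ω
    have h0 : 0 ≤ min (s * |X ω|) R := by positivity
    have e3 : ∀ u ∈ Set.Ioc 0 R, ({p : Ω × ℝ | p.2 / s < |X p.1|}.indicator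
        (fun p => Real.sin p.2) (ω, u)) = (Set.Iio (s * |X ω|)).indicator Real.sin u := by
      intro u _
      simp [Set.indicator, hY]
    rw [setIntegral_congr_fun measurableSet_Ioc e3, setIntegral_indicator measurableSet_Iio]
    have e4 : ∫ u in Set.Ioc 0 R ∩ Set.Iio (s * |X ω|), Real.sin u
        = ∫ u in Set.Ioc 0 (min (s * |X ω|) R), Real.sin u := by
      refine setIntegral_congr_set ?_
      have : ∀ᵐ u : ℝ, u ≠ s * |X ω| := by
        simp [ae_iff]
      filter_upwards [this] with u hu
      refine propext ⟨fun h => ?_, fun h => ?_⟩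
      · exact ⟨h.1.1, le_min (le_of_lt h.2) h.1.2⟩
      · exact ⟨⟨h.1, h.2.trans (min_le_right _ _)⟩,
          lt_of_le_of_ne (h.2.trans (min_le_left _ _)) hu⟩
    rw [e4, ← intervalIntegral.integral_of_le h0, integral_sin, Real.cos_zero]
  have hi : Integrable (fun ω => 1 - Real.cos (min (s * |X ω|) R)) P := by
    refine Integrable.of_bound (C := 2) (by fun_prop) (Eventually.of_forall fun ω => ?_)
    rw [Real.norm_eq_abs, abs_le]
    constructor <;> linarith [Real.cos_le_one (min (s * |X ω|) R),
      Real.neg_one_le_cos (min (s * |X ω|) R)]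
  rw [e1, ← integral_sub (integrable_one_sub_cos hX s) hi]
  refine (abs_integral_le_integral_abs).trans ?_
  have e5 : 2 * P.real {ω | R / s < |X ω|}
      = ∫ ω, {ω | R / s < |X ω|}.indicator (fun _ => (2 : ℝ)) ω ∂P := by
    rw [integral_indicator_const _ (hms R), smul_eq_mul, mul_comm]
  rw [e5]
  refine integral_mono_of_nonneg (Eventually.of_forall fun ω => abs_nonneg _)
    ((integrable_const _).indicator (hms R)) (Eventually.of_forall fun ω => ?_)
  have ec : Real.cos (s * X ω) = Real.cos (s * |X ω|) := by
    rcases abs_choice (X ω) with h | h <;> simp [h]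
  simp only [ec]
  by_cases h : R / s < |X ω|
  · rw [Set.indicator_of_mem (by exact h), abs_le]
    constructor <;> linarith [Real.cos_le_one (min (s * |X ω|) R),
      Real.neg_one_le_cos (min (s * |X ω|) R), Real.cos_le_one (s * |X ω|),
      Real.neg_one_le_cos (s * |X ω|)]
  · rw [Set.indicator_of_notMem (by exact h), min_eq_left (not_lt.1 fun h' => h ((hY _ _).2 h'))]
    simp

/-- Beyond some `x₂` the equivalence gives the bound; below it the trivial bound `1 ≤ (x₂ / x) ^ α`
does. The uniformity in `x` is what domination requires. -/
lemma exists_tail_le [IsProbabilityMeasure P] {α C : ℝ} (hα : 0 < α)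
    (h : Asymptotics.IsEquivalent atTop (fun x : ℝ => P.real {ω | x < |X ω|})
      (fun x : ℝ => C * x ^ (-α))) :
    ∃ K, 0 ≤ K ∧ ∀ x, 0 < x → P.real {ω | x < |X ω|} ≤ K * x ^ (-α) := by
  obtain ⟨c, hc⟩ := (h.isBigO).bound
  obtain ⟨x₁, hx₁⟩ := eventually_atTop.1 hc
  set x₂ := max x₁ 1
  have hx₂ : 0 < x₂ := by positivity
  refine ⟨|c| * |C| + x₂ ^ α, by positivity, fun x hx => ?_⟩
  have hp : 0 < x ^ (-α) := by positivity
  rcases le_total x₂ x with h1 | h1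
  · have h2 := hx₁ x ((le_max_left _ _).trans h1)
    rw [Real.norm_eq_abs, Real.norm_eq_abs, abs_mul, abs_of_pos hp] at h2
    have h3 : 0 ≤ x₂ ^ α := by positivity
    calc _ ≤ _ := le_abs_self _
      _ ≤ _ := h2
      _ ≤ |c| * (|C| * x ^ (-α)) := by gcongr; exact le_abs_self _
      _ ≤ _ := by nlinarith
  · have h2 : 1 ≤ x₂ ^ α * x ^ (-α) := by
      rw [Real.rpow_neg hx.le, ← div_eq_mul_inv, one_le_div (by positivity)]
      exact Real.rpow_le_rpow hx.le h1 hα.le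
    calc _ ≤ (1 : ℝ) := measureReal_le_one
      _ ≤ _ := h2
      _ ≤ _ := by
        have : 0 ≤ |c| * |C| * x ^ (-α) := by positivity
        nlinarith

lemma tendsto_tail_div_rpow {α C : ℝ} (hC : 0 < C)
    (h : Asymptotics.IsEquivalent atTop (fun x : ℝ => P.real {ω | x < |X ω|})
      (fun x : ℝ => C * x ^ (-α))) {u : ℝ} (hu : 0 < u) :
    Tendsto (fun s : ℝ => P.real {ω | u / s < |X ω|} / s ^ α) (𝓝[>] 0) (𝓝 (C * u ^ (-α))) := by
  have h1 : Tendsto (fun x : ℝ => P.real {ω | x < |X ω|} / (C * x ^ (-α))) atTop (𝓝 1) := by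
    refine (Asymptotics.isEquivalent_iff_tendsto_one ?_).1 h
    filter_upwards [eventually_gt_atTop 0] with x hx
    positivity
  have h2 : Tendsto (fun s : ℝ => u / s) (𝓝[>] 0) atTop := by
    simpa [div_eq_mul_inv] using tendsto_inv_nhdsGT_zero.const_mul_atTop hu
  have h3 := (h1.comp h2).const_mul (C * u ^ (-α))
  rw [mul_one] at h3
  refine h3.congr' ?_
  filter_upwards [self_mem_nhdsWithin] with s hs
  have hs : 0 < s := hs
  simp only [Function.comp]
  rw [Real.div_rpow hu.le hs.le, Real.rpow_neg hs.le]
  field_simp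

/-- The tail integral need not converge absolutely, so it is cut at `R`. Dividing the truncated
formula by `s ^ α` leaves an error tending to `2 C R ^ (-α)` as `s → 0`, which vanishes as `R → ∞`.
-/
lemma tendsto_integral_one_sub_cos_div_rpow [IsProbabilityMeasure P] (hX : Measurable X) {α C : ℝ} (hα : 0 < α)
    (hα2 : α < 2) (hC : 0 < C)
    (h : Asymptotics.IsEquivalent atTop (fun x : ℝ => P.real {ω | x < |X ω|})
      (fun x : ℝ => C * x ^ (-α))) :
    Tendsto (fun s : ℝ => (∫ ω, (1 - Real.cos (s * X ω)) ∂P) / s ^ α) (𝓝[>] 0)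
      (𝓝 (C * (stableConst α)⁻¹)) := by
  obtain ⟨K, hK0, hK⟩ := exists_tail_le hα h
  have hI : ∀ R, 0 < R → Tendsto (fun s : ℝ =>
      (∫ u in (0 : ℝ)..R, Real.sin u * P.real {ω | u / s < |X ω|}) / s ^ α) (𝓝[>] 0)
      (𝓝 (C * ∫ u in (0 : ℝ)..R, u ^ (-α) * Real.sin u)) := by
    intro R hR
    simp_rw [← intervalIntegral.integral_div, ← intervalIntegral.integral_const_mul]
    -- Near zero `|sin u| ≤ u` improves the tail bound to `u ^ (1 - α)`, integrable because `α < 2`.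
    refine intervalIntegral.tendsto_integral_filter_of_dominated_convergence
      (fun u => K * u ^ (1 - α)) ?_ ?_ ?_ ?_
    · refine Eventually.of_forall fun s => Measurable.aestronglyMeasurable ?_
      have : Measurable fun u : ℝ => P.real {ω | u / s < |X ω|} := by
        have hs : MeasurableSet {p : ℝ × Ω | p.1 / s < |X p.2|} :=
          measurableSet_lt (by fun_prop) (by fun_prop)
        exact (measurable_measure_prodMk_left hs).ennreal_toReal
      fun_prop
    · filter_upwards [self_mem_nhdsWithin] with s hs
      refine Eventually.of_forall fun u hu => ?_
      rw [Set.uIoc_of_le hR.le] at hu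
      have hs : 0 < s := hs
      have hu0 : 0 < u := hu.1
      have h1 := hK (u / s) (by positivity)
      rw [Real.div_rpow hu0.le hs.le, Real.rpow_neg hs.le, div_inv_eq_mul] at h1
      rw [norm_div, norm_mul, Real.norm_eq_abs, Real.norm_eq_abs, Real.norm_eq_abs,
        abs_of_nonneg measureReal_nonneg, abs_of_pos (Real.rpow_pos_of_pos hs α),
        div_le_iff₀ (by positivity)]
      have h2 : |Real.sin u| ≤ u := by
        have := Real.abs_sin_lt_abs hu0.ne'
        rw [abs_of_pos hu0] at this
        exact this.le
      have h3 : u ^ (1 - α) = u * u ^ (-α) := by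
        rw [sub_eq_add_neg, Real.rpow_add hu0, Real.rpow_one]
      rw [h3]
      calc _ ≤ u * (K * (u ^ (-α) * s ^ α)) := by gcongr
        _ = _ := by ring
    · exact (intervalIntegral.intervalIntegrable_rpow' (by linarith)).const_mul K
    · refine Eventually.of_forall fun u hu => ?_
      rw [Set.uIoc_of_le hR.le] at hu
      have h1 := (tendsto_tail_div_rpow hC h hu.1).const_mul (Real.sin u)
      refine (h1.congr fun s => ?_).trans (le_of_eq ?_)
      · rw [mul_div_assoc]
      · congr 1; ring
  have he : Tendsto (fun R : ℝ => 2 * C * R ^ (-α)) atTop (𝓝 0) := by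
    simpa using (tendsto_rpow_neg_atTop hα).const_mul (2 * C)
  obtain ⟨a, ha, hfa⟩ := exists_tendsto_of_forall_eventually_abs_sub_le (l := 𝓝[>] (0 : ℝ))
    (f := fun s : ℝ => (∫ ω, (1 - Real.cos (s * X ω)) ∂P) / s ^ α)
    (J := fun R => C * ∫ u in (0 : ℝ)..R, u ^ (-α) * Real.sin u) he (by
      intro R hR ε hε
      have h1 := Metric.tendsto_nhds.1 (hI R hR) (ε / 2) (half_pos hε)
      have h2 := Metric.tendsto_nhds.1 ((tendsto_tail_div_rpow hC h hR).const_mul 2) (ε / 2)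
        (half_pos hε)
      filter_upwards [h1, h2, self_mem_nhdsWithin] with s h1 h2 hs
      have hs : 0 < s := hs
      have hsα : 0 < s ^ α := by positivity
      rw [Real.dist_eq] at h1 h2
      have h3 := abs_integral_one_sub_cos_sub_le (P := P) hX hs hR
      have h4 := div_le_div_of_nonneg_right h3 hsα.le
      rw [← abs_of_pos hsα, ← abs_div, abs_of_pos hsα, sub_div] at h4
      have h5 := abs_sub_le ((∫ ω, (1 - Real.cos (s * X ω)) ∂P) / s ^ α)
        ((∫ u in (0 : ℝ)..R, Real.sin u * P.real {ω | u / s < |X ω|}) / s ^ α)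
        (C * ∫ u in (0 : ℝ)..R, u ^ (-α) * Real.sin u)
      rw [mul_div_assoc] at h4
      have h6 := (abs_lt.1 h2).2
      linarith)
  have h1 : Tendsto (fun R => ∫ u in (0 : ℝ)..R, u ^ (-α) * Real.sin u) atTop (𝓝 (C⁻¹ * a)) := by
    refine (ha.const_mul C⁻¹).congr fun R => ?_
    field_simp
  -- `limUnder` has its intended value only because `h1` proves convergence.
  rw [stableConst, if_neg hα2.ne, h1.limUnder_eq, inv_inv]
  convert hfa using 2
  field_simp

/-- The behaviour at zero of `s ↦ E (1 - cos (s X))`. -/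
lemma TailCondition.tendsto_symbol [IsProbabilityMeasure P] {α C : ℝ} (hX : Measurable X) (h : TailCondition α C X P) :
    Tendsto (fun s : ℝ => (∫ ω, (1 - Real.cos (s * X ω)) ∂P) / |s| ^ α) (𝓝[≠] 0)
      (𝓝 (C * (stableConst α)⁻¹)) := by
  have key : Tendsto (fun s : ℝ => (∫ ω, (1 - Real.cos (s * X ω)) ∂P) / s ^ α) (𝓝[>] 0)
      (𝓝 (C * (stableConst α)⁻¹)) := by
    rcases h with ⟨rfl, h2, rfl, -⟩ | ⟨h0, h2, hC, h⟩
    · rw [stableConst, if_pos rfl]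
      refine (tendsto_integral_one_sub_cos_div_sq hX h2).congr fun s => ?_
      norm_num
    · exact tendsto_integral_one_sub_cos_div_rpow hX h0 h2 hC h
  refine (key.comp (tendsto_abs_nhdsNE_zero)).congr fun s => ?_
  simp only [Function.comp]
  rw [integral_one_sub_cos_abs]

lemma TailCondition.pos {α C : ℝ} (h : TailCondition α C X P) : 0 < α := by
  rcases h with ⟨rfl, -⟩ | ⟨h, -⟩
  · norm_num
  · exact h

lemma TailCondition.const_pos {α C : ℝ} (h : TailCondition α C X P) : 0 < C := by
  rcases h with ⟨-, -, -, h⟩ | ⟨-, -, h, -⟩ <;> exact h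

/-- Close to zero the asymptotics allow the constant `D + 1`; for `|s| ≥ r` the bound 2 is absorbed
into `2 (|s| / r) ^ α`. -/
lemma TailCondition.exists_symbol_le [IsProbabilityMeasure P] {α C : ℝ} (hX : Measurable X) (h : TailCondition α C X P) :
    ∃ K, 0 ≤ K ∧ ∀ s : ℝ, ∫ ω, (1 - Real.cos (s * X ω)) ∂P ≤ K * |s| ^ α := by
  have hα := h.pos
  set D := C * (stableConst α)⁻¹
  have h1 := (h.tendsto_symbol hX).eventually (gt_mem_nhds (lt_add_one D))
  rw [eventually_nhdsWithin_iff, Metric.eventually_nhds_iff] at h1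
  obtain ⟨r, hr, h1⟩ := h1
  refine ⟨|D + 1| + 2 / r ^ α, by positivity, fun s => ?_⟩
  have hs0 : 0 ≤ |s| ^ α := by positivity
  have hr0 : 0 ≤ 2 / r ^ α := by positivity
  rcases eq_or_ne s 0 with rfl | hs
  · simp only [zero_mul, Real.cos_zero, sub_self, integral_zero]
    positivity
  have hsp : 0 < |s| ^ α := by positivity
  rcases lt_or_ge |s| r with h2 | h2
  · have h3 := h1 (by simpa using h2) hs
    rw [div_lt_iff₀ hsp] at h3
    nlinarith [le_abs_self (D + 1)]
  · have h3 : r ^ α ≤ |s| ^ α := Real.rpow_le_rpow hr.le h2 hα.le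
    have h4 : 2 ≤ 2 / r ^ α * |s| ^ α := by
      rw [div_mul_eq_mul_div, le_div_iff₀ (by positivity)]
      linarith
    have h5 := integral_one_sub_cos_le_two (P := P) (X := X) s
    nlinarith [abs_nonneg (D + 1)]

end Symbol

/-! ### Walsh functions and finite Bernoulli expectations. -/

/-- The Walsh function indexed by `S`, evaluated at the indicator of `A`. -/
def walsh {ι : Type*} [DecidableEq ι] (S A : Finset ι) : ℝ :=
  ∏ k ∈ S, (if k ∈ A then -1 else 1)

/-- Orthogonality of characters: `∑ S, walsh S B * walsh S A` is a product of factors `1 ± 1`,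
nonzero only for `A = B`. Laws of random subsets can therefore be compared on products of signs. -/
lemma exists_eq_sum_walsh {ι : Type*} [Fintype ι] [DecidableEq ι] (F : Finset ι → ℝ) :
    ∃ c : Finset ι → ℝ, ∀ A, F A = ∑ S, c S * walsh S A := by
  refine ⟨fun S => ∑ B, F B * ((2 : ℝ) ^ Fintype.card ι)⁻¹ * walsh S B, fun A => ?_⟩
  have h1 : ∀ B : Finset ι, ∑ S : Finset ι, walsh S B * walsh S A =
      if B = A then (2 : ℝ) ^ Fintype.card ι else 0 := by
    intro B
    have h2 : ∑ S : Finset ι, walsh S B * walsh S A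
        = ∏ k : ι, (1 + (if k ∈ B then -1 else 1) * (if k ∈ A then (-1 : ℝ) else 1)) := by
      rw [Finset.prod_one_add, Finset.powerset_univ]
      simp only [walsh, Finset.prod_mul_distrib]
    rw [h2]
    split_ifs with h
    · subst h
      rw [Finset.prod_congr rfl (g := fun _ => (2 : ℝ))]
      · simp
      · intro k _; split_ifs <;> norm_num
    · obtain ⟨k, hk⟩ : ∃ k, ¬ (k ∈ B ↔ k ∈ A) := by
        by_contra! h'
        exact h (Finset.ext h')
      refine Finset.prod_eq_zero (Finset.mem_univ k) ?_
      by_cases hB : k ∈ B <;> by_cases hA : k ∈ A <;> simp_all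
  calc F A = ∑ B, F B * ((2 : ℝ) ^ Fintype.card ι)⁻¹ *
        (if B = A then (2 : ℝ) ^ Fintype.card ι else 0) := by
        simp
    _ = _ := by
      simp_rw [← h1, Finset.mul_sum, Finset.sum_mul]
      rw [Finset.sum_comm]
      simp_rw [mul_assoc]

/-- The expectation of `G {j < n | η j = 1}` for independent Bernoulli(`p`) variables `η j`. -/
def bernoulliExp (n : ℕ) (p : ℝ) (G : Finset ℕ → ℝ) : ℝ :=
  ∑ E ∈ (Finset.range n).powerset, (∏ j ∈ Finset.range n, if j ∈ E then p else 1 - p) * G E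

/-- Independence of the trials: each time `j` contributes the factor `p f j + (1 - p)`. -/
lemma bernoulliExp_prod (n : ℕ) (p : ℝ) (f : ℕ → ℝ) :
    bernoulliExp n p (fun E => ∏ j ∈ Finset.range n, if j ∈ E then f j else 1)
      = ∏ j ∈ Finset.range n, (1 + p * (f j - 1)) := by
  have h1 : ∀ j, 1 + p * (f j - 1) = p * f j + (1 - p) := fun j => by ring
  simp_rw [h1]
  rw [Finset.prod_add, bernoulliExp]
  refine Finset.sum_congr rfl fun E hE => ?_
  have hE' := Finset.mem_powerset.1 hE
  rw [← Finset.prod_mul_distrib, ← Finset.prod_sdiff hE', mul_comm]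
  congr 1
  · exact Finset.prod_congr rfl fun j hj => by simp [hj]
  · exact Finset.prod_congr rfl fun j hj => by simp [(Finset.mem_sdiff.1 hj).2]

lemma bernoulliExp_one (n : ℕ) (p : ℝ) : bernoulliExp n p (fun _ => 1) = 1 := by
  have := bernoulliExp_prod n p (fun _ => 1)
  simpa using this

lemma bernoulliExp_mono {n : ℕ} {p : ℝ} (h0 : 0 ≤ p) (h1 : p ≤ 1) {F G : Finset ℕ → ℝ}
    (h : ∀ E ⊆ Finset.range n, F E ≤ G E) : bernoulliExp n p F ≤ bernoulliExp n p G := by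
  refine Finset.sum_le_sum fun E hE => ?_
  refine mul_le_mul_of_nonneg_left (h E (Finset.mem_powerset.1 hE)) ?_
  exact Finset.prod_nonneg fun j _ => by split_ifs <;> linarith

lemma bernoulliExp_sum {ι : Type*} (s : Finset ι) (n : ℕ) (p : ℝ) (c : ι → ℝ)
    (G : ι → Finset ℕ → ℝ) :
    bernoulliExp n p (fun E => ∑ i ∈ s, c i * G i E) = ∑ i ∈ s, c i * bernoulliExp n p (G i) := by
  simp only [bernoulliExp, Finset.mul_sum]
  rw [Finset.sum_comm]
  exact Finset.sum_congr rfl fun i _ => Finset.sum_congr rfl fun E _ => by ring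

lemma bernoulliExp_const_mul (n : ℕ) (p c : ℝ) (G : Finset ℕ → ℝ) :
    bernoulliExp n p (fun E => c * G E) = c * bernoulliExp n p G := by
  simpa using bernoulliExp_sum {()} n p (fun _ => c) (fun _ => G)

/-- Bernoulli's inequality for the probability that some `η j` equals one. -/
lemma bernoulliExp_nonempty_le {n : ℕ} {p : ℝ} (h1 : p ≤ 1) :
    bernoulliExp n p (fun E => if E = ∅ then 0 else 1) ≤ min 1 (n * p) := by
  have h2 : bernoulliExp n p (fun E => if E = ∅ then 0 else 1) = 1 - (1 - p) ^ n := by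
    have e1 := bernoulliExp_prod n p (fun _ => 0)
    have e2 : bernoulliExp n p (fun E => if E = ∅ then 0 else 1)
        = bernoulliExp n p (fun _ => 1) -
          bernoulliExp n p (fun E => ∏ j ∈ Finset.range n, if j ∈ E then 0 else 1) := by
      simp only [bernoulliExp]
      rw [← Finset.sum_sub_distrib]
      refine Finset.sum_congr rfl fun E hE => ?_
      rw [← mul_sub]
      congr 1
      split_ifs with h
      · simp [h]
      · obtain ⟨j, hj⟩ := Finset.nonempty_iff_ne_empty.2 h
        rw [Finset.prod_eq_zero (Finset.mem_powerset.1 hE hj) (by simp [hj])]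
        simp
    rw [e2, e1, bernoulliExp_one]
    simp [sub_eq_add_neg]
  rw [h2]
  have h3 := one_add_mul_le_pow (a := -p) (by linarith) n
  have h4 : (0 : ℝ) ≤ (1 - p) ^ n := pow_nonneg (by linarith) n
  rw [← sub_eq_add_neg] at h3
  exact le_min (by linarith) (by linarith)

/-- The set of times at which the counting process of `E` is odd. -/
def oddSet {ι : Type*} [Fintype ι] (N : ι → ℕ) (E : Finset ℕ) : Finset ι :=
  Finset.univ.filter fun k => Odd (E ∩ Finset.range (N k)).card

lemma oddSet_empty {ι : Type*} [Fintype ι] (N : ι → ℕ) : oddSet N ∅ = ∅ := by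
  simp [oddSet]

lemma ite_odd_eq_pow (n : ℕ) : (if Odd n then (-1 : ℝ) else 1) = (-1) ^ n := by
  split_ifs with h
  · exact h.neg_one_pow.symm
  · exact (Nat.not_odd_iff_even.1 h).neg_one_pow.symm

/-- Each sign is `-1` to the number of successes before `N k`, hence a product over times.
Exchanging the products over `k` and `j` gives the form required by `bernoulliExp_prod`. -/
lemma walsh_oddSet {ι : Type*} [Fintype ι] [DecidableEq ι] {n : ℕ} {N : ι → ℕ}
    (S : Finset ι) {E : Finset ℕ} (hE : E ⊆ Finset.range n) :
    walsh S (oddSet N E) = ∏ j ∈ Finset.range n,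
      if j ∈ E then ∏ k ∈ S, (if j < N k then -1 else 1) else 1 := by
  have h1 : ∀ k, (if k ∈ oddSet N E then (-1 : ℝ) else 1)
      = ∏ j ∈ Finset.range n, if j ∈ E then (if j < N k then -1 else 1) else 1 := by
    intro k
    simp only [oddSet, Finset.mem_filter, Finset.mem_univ, true_and]
    rw [ite_odd_eq_pow, ← Finset.prod_const]
    rw [← Finset.prod_filter, Finset.prod_ite]
    simp only [Finset.prod_const, one_pow, mul_one]
    congr 2
    ext j
    simp only [Finset.mem_inter, Finset.mem_range, Finset.mem_filter]
    constructor
    · rintro ⟨a, b⟩; exact ⟨⟨Finset.mem_range.1 (hE a), a⟩, b⟩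
    · rintro ⟨⟨_, a⟩, b⟩; exact ⟨a, b⟩
  simp only [walsh, h1]
  rw [Finset.prod_comm]
  refine Finset.prod_congr rfl fun j _ => ?_
  split_ifs <;> simp

lemma bernoulliExp_congr {n : ℕ} {p : ℝ} {F G : Finset ℕ → ℝ}
    (h : ∀ E ⊆ Finset.range n, F E = G E) : bernoulliExp n p F = bernoulliExp n p G :=
  Finset.sum_congr rfl fun E hE => by rw [h E (Finset.mem_powerset.1 hE)]

/-! ### Limits of Walsh expectations for Bernoulli trials. -/

/-- The sign function `x ↦ ∏_{k ∈ S} (-1)^{1{x ≤ t k}}`. -/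
noncomputable def signProd {ι : Type*} (t : ι → ℝ) (S : Finset ι) (x : ℝ) : ℝ :=
  ∏ k ∈ S, (if x ≤ t k then -1 else 1)

lemma measurable_signProd {ι : Type*} (t : ι → ℝ) (S : Finset ι) : Measurable (signProd t S) :=
  Finset.measurable_prod _ fun _ _ =>
    Measurable.ite measurableSet_Iic measurable_const measurable_const

lemma abs_prod_ite_neg_one {ι : Type*} (S : Finset ι) (p : ι → Prop) [DecidablePred p] :
    |∏ k ∈ S, (if p k then (-1 : ℝ) else 1)| = 1 := by
  rw [Finset.abs_prod]
  exact Finset.prod_eq_one fun k _ => by split_ifs <;> simp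

lemma abs_signProd {ι : Type*} (t : ι → ℝ) (S : Finset ι) (x : ℝ) : |signProd t S x| = 1 :=
  abs_prod_ite_neg_one _ _

lemma intervalIntegrable_signProd {ι : Type*} (t : ι → ℝ) (S : Finset ι) (a b : ℝ) :
    IntervalIntegrable (signProd t S) volume a b := by
  refine (intervalIntegrable_const (c := (1 : ℝ))).mono_fun
    (measurable_signProd t S).aestronglyMeasurable (Eventually.of_forall fun x => ?_)
  exact (abs_signProd t S x).le.trans (by simp)

lemma sum_range_eq_integral_floor (g : ℕ → ℝ) (n : ℕ) :
    IntervalIntegrable (fun x : ℝ => g ⌊x⌋₊) volume 0 n ∧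
      ∑ j ∈ Finset.range n, g j = ∫ x in (0 : ℝ)..n, g ⌊x⌋₊ := by
  have h1 : ∀ j : ℕ, ∀ᵐ x ∂volume, x ∈ Set.uIoc (j : ℝ) ((j + 1 : ℕ) : ℝ) → g ⌊x⌋₊ = g j := by
    intro j
    have : ∀ᵐ x : ℝ, x ≠ ((j + 1 : ℕ) : ℝ) := by simp [ae_iff]
    filter_upwards [this] with x hx hx'
    rw [Set.uIoc_of_le (by simp)] at hx'
    congr 1
    rw [Nat.floor_eq_iff (by linarith [hx'.1, (Nat.cast_nonneg j : (0 : ℝ) ≤ j)])]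
    refine ⟨hx'.1.le, ?_⟩
    have := lt_of_le_of_ne hx'.2 hx
    push_cast at this
    exact this
  have h2 : ∀ j : ℕ, IntervalIntegrable (fun x : ℝ => g ⌊x⌋₊) volume (j : ℝ) ((j + 1 : ℕ) : ℝ) :=
    fun j => (intervalIntegrable_const (c := g j)).congr_ae (by
      rw [EventuallyEq, ae_restrict_iff' measurableSet_uIoc]
      filter_upwards [h1 j] with x hx hx'
      exact (hx hx').symm)
  have h3 := intervalIntegral.sum_integral_adjacent_intervals (f := fun x : ℝ => g ⌊x⌋₊)
    (a := fun j : ℕ => (j : ℝ)) (n := n) (μ := volume) fun j _ => h2 j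
  have h4 := IntervalIntegrable.trans_iterate (f := fun x : ℝ => g ⌊x⌋₊)
    (a := fun j : ℕ => (j : ℝ)) (n := n) (μ := volume) fun j _ => h2 j
  simp only [Nat.cast_zero] at h3 h4
  refine ⟨h4, ?_⟩
  rw [← h3]
  refine Finset.sum_congr rfl fun j _ => ?_
  rw [intervalIntegral.integral_congr_ae (h1 j)]
  simp

/-- Once `n (t - x) > 1` the floors separate; if `x > t`, monotonicity of the floor already decides.
The excluded point `x = t` is negligible in the Riemann sums. -/
lemma tendsto_floor_lt_iff {x t : ℝ} (hx : 0 ≤ x) (hxt : x ≠ t) :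
    ∀ᶠ n : ℕ in atTop, (⌊(n : ℝ) * x⌋₊ < ⌊(n : ℝ) * t⌋₊ ↔ x ≤ t) := by
  rcases lt_or_gt_of_ne hxt with h | h
  · obtain ⟨m, hm⟩ := exists_nat_gt (1 / (t - x))
    filter_upwards [eventually_ge_atTop m] with n hn
    have hn' : 1 / (t - x) < n := hm.trans_le (by exact_mod_cast hn)
    rw [div_lt_iff₀ (sub_pos.2 h)] at hn'
    refine iff_of_true ?_ h.le
    rw [← Nat.succ_le_iff, Nat.le_floor_iff (by nlinarith [(Nat.cast_nonneg n : (0 : ℝ) ≤ n)])]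
    have := Nat.floor_le (show 0 ≤ (n : ℝ) * x by positivity)
    push_cast
    nlinarith
  · refine Eventually.of_forall fun n => iff_of_false ?_ (not_le.2 h)
    rw [not_lt]
    exact Nat.floor_mono (by gcongr)

/-- Riemann sums of the discretized sign functions. -/
lemma tendsto_sum_sign_div {ι : Type*} (t : ι → ℝ) (S : Finset ι) :
    Tendsto (fun n : ℕ => (∑ j ∈ Finset.range n,
        ∏ k ∈ S, (if j < ⌊(n : ℝ) * t k⌋₊ then (-1 : ℝ) else 1)) / n) atTop
      (𝓝 (∫ x in (0 : ℝ)..1, signProd t S x)) := by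
  have h1 : Tendsto (fun n : ℕ => ∫ x in (0 : ℝ)..1,
      ∏ k ∈ S, (if ⌊(n : ℝ) * x⌋₊ < ⌊(n : ℝ) * t k⌋₊ then (-1 : ℝ) else 1)) atTop
      (𝓝 (∫ x in (0 : ℝ)..1, signProd t S x)) := by
    refine intervalIntegral.tendsto_integral_filter_of_dominated_convergence (fun _ => 1)
      (Eventually.of_forall fun n => ?_) ?_ intervalIntegrable_const ?_
    · refine (Finset.measurable_prod _ fun k _ => ?_).aestronglyMeasurable
      refine Measurable.ite ?_ measurable_const measurable_const
      exact measurableSet_lt (Nat.measurable_floor.comp (by fun_prop)) measurable_const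
    · refine Eventually.of_forall fun n => Eventually.of_forall fun x _ => ?_
      rw [Real.norm_eq_abs, abs_prod_ite_neg_one]
    · have : ∀ᵐ x : ℝ, ∀ k ∈ S, x ≠ t k := by
        refine (ae_ball_iff S.countable_toSet).2 fun k _ => ?_
        simp [ae_iff]
      filter_upwards [this] with x hx hx'
      rw [Set.uIoc_of_le zero_le_one] at hx'
      refine tendsto_nhds_of_eventually_eq ?_
      have := (Finset.eventually_all S).2 fun k hk => tendsto_floor_lt_iff hx'.1.le (hx k hk)
      filter_upwards [this] with n hn
      exact Finset.prod_congr rfl fun k hk => by simp only [hn k hk]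
  refine h1.congr' ?_
  filter_upwards [eventually_gt_atTop 0] with n hn
  have hn' : (n : ℝ) ≠ 0 := by positivity
  rw [(sum_range_eq_integral_floor (fun j =>
    ∏ k ∈ S, (if j < ⌊(n : ℝ) * t k⌋₊ then (-1 : ℝ) else 1)) n).2]
  have := intervalIntegral.integral_comp_mul_left (a := 0) (b := 1) (fun x : ℝ =>
    ∏ k ∈ S, (if ⌊x⌋₊ < ⌊(n : ℝ) * t k⌋₊ then (-1 : ℝ) else 1)) hn'
  rw [this]
  simp [div_eq_inv_mul]

/-- The factors are 1 or `1 - 2u/n` according to the sign `f n j`, so the product is a power of `1 -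
2u/n`. Its exponent divided by `n` is half of one minus the average sign, a Riemann sum. -/
lemma tendsto_bernoulliExp_walsh {ι : Type*} [Fintype ι] [DecidableEq ι] (t : ι → ℝ)
    (S : Finset ι) {u : ℝ} (hu : 0 < u) :
    Tendsto (fun n : ℕ => bernoulliExp n (u / n)
        (fun E => walsh S (oddSet (fun k => ⌊(n : ℝ) * t k⌋₊) E))) atTop
      (𝓝 (Real.exp (u * ((∫ x in (0 : ℝ)..1, signProd t S x) - 1)))) := by
  set f : ℕ → ℕ → ℝ := fun n j => ∏ k ∈ S, (if j < ⌊(n : ℝ) * t k⌋₊ then (-1 : ℝ) else 1)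
  have h1 : Tendsto (fun n : ℕ => (n : ℝ) * Real.log (1 + -2 * u / n)) atTop (𝓝 (-2 * u)) :=
    (Real.tendsto_mul_log_one_add_div_atTop (-2 * u)).comp tendsto_natCast_atTop_atTop
  have h2 := h1.mul ((tendsto_const_nhds (x := (1 : ℝ))).sub (tendsto_sum_sign_div t S))
  have h3 := (h2.const_mul (1 / 2)).rexp
  have e : 1 / 2 * (-2 * u * (1 - ∫ x in (0 : ℝ)..1, signProd t S x))
      = u * ((∫ x in (0 : ℝ)..1, signProd t S x) - 1) := by ring
  rw [e] at h3
  refine h3.congr' ?_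
  obtain ⟨m, hm⟩ := exists_nat_gt (2 * u)
  filter_upwards [eventually_ge_atTop m] with n hn
  have hn' : 2 * u < n := hm.trans_le (by exact_mod_cast hn)
  have hn0 : (0 : ℝ) < n := by linarith
  have hp : 0 < 1 + -2 * u / n := by
    have : 2 * u / n < 1 := (div_lt_one hn0).2 hn'
    have e : -2 * u / n = -(2 * u / n) := by ring
    linarith
  rw [bernoulliExp_congr (G := fun E => ∏ j ∈ Finset.range n, if j ∈ E then f n j else 1)
    (fun E hE => walsh_oddSet S hE), bernoulliExp_prod]
  have h4 : ∀ j ∈ Finset.range n, 1 + u / n * (f n j - 1)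
      = Real.exp (Real.log (1 + -2 * u / n) * ((1 - f n j) / 2)) := by
    intro j _
    have h5 : |f n j| = 1 := abs_prod_ite_neg_one S _
    rcases eq_or_eq_neg_of_abs_eq h5 with h | h
    · simp [h]
    · rw [h, show ((1 : ℝ) - -1) / 2 = 1 by norm_num, mul_one, Real.exp_log hp]; ring
  rw [Finset.prod_congr rfl h4, ← Real.exp_sum, ← Finset.mul_sum, ← Finset.sum_div,
    Finset.sum_sub_distrib]
  congr 1
  simp only [Finset.sum_const, Finset.card_range, nsmul_eq_mul, mul_one]
  field_simp
  ring

/-! ### Walsh expectations of the Poisson process and convergence of the parities. -/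

lemma integral_infinitePi_prod_range {X : ℕ → Type*} [∀ i, MeasurableSpace (X i)]
    (μ : ∀ i, Measure (X i)) [∀ i, IsProbabilityMeasure (μ i)] {f : ∀ i, X i → ℝ}
    (hf : ∀ i, Measurable (f i)) (k : ℕ) :
    ∫ x, ∏ i ∈ Finset.range k, f i (x i) ∂(Measure.infinitePi μ)
      = ∏ i ∈ Finset.range k, ∫ y, f i y ∂(μ i) := by
  have h1 : iIndepFun (fun (i : Fin k) (x : ∀ i, X i) => f i (x i)) (Measure.infinitePi μ) :=
    (iIndepFun_infinitePi (P := μ) (X := f) hf).precomp Fin.val_injective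
  simp_rw [Finset.prod_range]
  rw [h1.integral_fun_prod_eq_prod_integral fun i =>
    ((hf i).comp (measurable_pi_apply _)).aestronglyMeasurable]
  refine Finset.prod_congr rfl fun i _ => ?_
  rw [← (measurePreserving_eval_infinitePi μ (i : ℕ)).map_eq,
    integral_map (measurable_pi_apply _).aemeasurable (hf i).aestronglyMeasurable]

/-- The exponential formula for one cell of the Poisson process. -/
lemma integral_poisson_cell {g : unitInterval → ℝ} (hg : Measurable g) (hg1 : ∀ x, |g x| ≤ 1) :
    Measurable (fun p : ℕ × (ℕ → unitInterval) => ∏ i ∈ Finset.range p.1, g (p.2 i)) ∧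
    ∫ p, ∏ i ∈ Finset.range p.1, g (p.2 i) ∂((poissonMeasure 1).prod
        (Measure.infinitePi (fun _ : ℕ => (volume : Measure unitInterval))))
      = Real.exp ((∫ x, g x) - 1) := by
  have hm : Measurable (fun p : ℕ × (ℕ → unitInterval) => ∏ i ∈ Finset.range p.1, g (p.2 i)) := by
    refine measurable_from_prod_countable_right fun k => ?_
    exact Finset.measurable_prod (Finset.range k) (f := fun i (U : ℕ → unitInterval) => g (U i))
      fun i _ => hg.comp (measurable_pi_apply i)
  refine ⟨hm, ?_⟩
  rw [integral_prod]
  · have h1 : ∀ k : ℕ, ∫ U : ℕ → unitInterval, ∏ i ∈ Finset.range k, g (U i)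
        ∂(Measure.infinitePi (fun _ : ℕ => (volume : Measure unitInterval))) = (∫ x, g x) ^ k := by
      intro k
      rw [integral_infinitePi_prod_range (fun _ : ℕ => (volume : Measure unitInterval))
        (f := fun _ => g) (fun _ => hg)]
      simp
    simp_rw [h1]
    rw [integral_poissonMeasure, sub_eq_neg_add, Real.exp_add, Real.exp_eq_exp_ℝ,
      NormedSpace.exp_eq_tsum_div, ← tsum_mul_left]
    refine tsum_congr fun k => ?_
    simp only [NNReal.coe_one, one_pow, mul_one, smul_eq_mul]
    ring
  · refine Integrable.of_bound (C := 1) hm.aestronglyMeasurable (Eventually.of_forall fun p => ?_)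
    rw [Real.norm_eq_abs, Finset.abs_prod]
    exact Finset.prod_le_one (fun _ _ => abs_nonneg _) fun i _ => hg1 _

/-- Points of cell `k` lie at or beyond `k`, so later cells add nothing. One number `M` of cells
then serves several times at once. -/
lemma poissonCount_eq_sum {s : ℝ} {M : ℕ} (hM : ⌊s⌋₊ + 1 ≤ M) (ω : PoissonSpace) :
    poissonCount s ω = ∑ k ∈ Finset.range M,
      ((Finset.range (ω k).1).filter (fun i => (k : ℝ) + ((ω k).2 i : ℝ) ≤ s)).card := by
  rw [poissonCount]
  refine Finset.sum_subset (Finset.range_mono hM) fun k _ hk => ?_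
  rw [Finset.card_eq_zero, Finset.filter_eq_empty_iff]
  intro i _
  rw [not_le]
  have h1 : ⌊s⌋₊ + 1 ≤ k := by simpa using hk
  have h2 : s < ⌊s⌋₊ + 1 := Nat.lt_floor_add_one s
  have h3 : ((⌊s⌋₊ + 1 : ℕ) : ℝ) ≤ k := by exact_mod_cast h1
  push_cast at h3
  linarith [((ω k).2 i).2.1]

/-- The set of times at which the Poisson process is odd. -/
noncomputable def poissonOddSet {ι : Type*} [Fintype ι] (s : ι → ℝ) (ω : PoissonSpace) : Finset ι :=
  Finset.univ.filter fun k => Odd (poissonCount (s k) ω)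

lemma walsh_poissonOddSet {ι : Type*} [Fintype ι] [DecidableEq ι] {s : ι → ℝ} {M : ℕ}
    (hM : ∀ k, ⌊s k⌋₊ + 1 ≤ M) (S : Finset ι) (ω : PoissonSpace) :
    walsh S (poissonOddSet s ω) = ∏ m ∈ Finset.range M, ∏ i ∈ Finset.range (ω m).1,
      signProd s S (m + ((ω m).2 i : ℝ)) := by
  have h1 : ∀ k, (if k ∈ poissonOddSet s ω then (-1 : ℝ) else 1)
      = ∏ m ∈ Finset.range M, ∏ i ∈ Finset.range (ω m).1,
        if (m : ℝ) + ((ω m).2 i : ℝ) ≤ s k then -1 else 1 := by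
    intro k
    simp only [poissonOddSet, Finset.mem_filter, Finset.mem_univ, true_and]
    rw [ite_odd_eq_pow, poissonCount_eq_sum (hM k), ← Finset.prod_pow_eq_pow_sum]
    refine Finset.prod_congr rfl fun m _ => ?_
    rw [Finset.prod_ite]
    simp
  simp only [walsh, h1, signProd]
  rw [Finset.prod_comm]
  exact Finset.prod_congr rfl fun m _ => Finset.prod_comm

lemma integral_unitInterval (g : ℝ → ℝ) : ∫ x : unitInterval, g x = ∫ x in (0 : ℝ)..1, g x := by
  rw [intervalIntegral.integral_of_le zero_le_one, ← integral_Icc_eq_integral_Ioc]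
  exact integral_subtype_comap measurableSet_Icc g

/-- The sign carried by the points of the Poisson process in the `m`-th cell. -/
noncomputable def cellSign {ι : Type*} (s : ι → ℝ) (S : Finset ι) (m : ℕ)
    (p : ℕ × (ℕ → unitInterval)) : ℝ :=
  ∏ i ∈ Finset.range p.1, signProd s S (m + (p.2 i : ℝ))

lemma cellSign_spec {ι : Type*} (s : ι → ℝ) (S : Finset ι) (m : ℕ) :
    Measurable (cellSign s S m) ∧
    ∫ p, cellSign s S m p ∂((poissonMeasure 1).prod
        (Measure.infinitePi (fun _ : ℕ => (volume : Measure unitInterval))))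
      = Real.exp ((∫ x in ((m : ℕ) : ℝ)..((m + 1 : ℕ) : ℝ), signProd s S x) - 1) := by
  have hg : Measurable fun x : unitInterval => signProd s S (m + (x : ℝ)) :=
    (measurable_signProd s S).comp (by fun_prop)
  have hg1 : ∀ x : unitInterval, |signProd s S (m + (x : ℝ))| ≤ 1 := fun x =>
    (abs_signProd _ _ _).le
  have h1 : ∫ x : unitInterval, signProd s S (m + (x : ℝ))
      = ∫ x in ((m : ℕ) : ℝ)..((m + 1 : ℕ) : ℝ), signProd s S x := by
    rw [integral_unitInterval (fun x => signProd s S (m + x)),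
      intervalIntegral.integral_comp_add_left]
    simp
  rw [← h1]
  exact integral_poisson_cell hg hg1

/-- The cells are independent, so their exponential formulas multiply and the integrals in the
exponents concatenate to `[0, M]`. -/
lemma integral_walsh_poissonOddSet {ι : Type*} [Fintype ι] [DecidableEq ι] {s : ι → ℝ} {M : ℕ}
    (hM : ∀ k, ⌊s k⌋₊ + 1 ≤ M) (S : Finset ι) :
    Measurable (fun ω => walsh S (poissonOddSet s ω)) ∧
    ∫ ω, walsh S (poissonOddSet s ω) ∂poissonLaw
      = Real.exp ((∫ x in (0 : ℝ)..M, signProd s S x) - M) := by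
  have h0 : (fun ω => walsh S (poissonOddSet s ω))
      = fun ω : PoissonSpace => ∏ m ∈ Finset.range M, cellSign s S m (ω m) :=
    funext fun ω => walsh_poissonOddSet hM S ω
  rw [h0]
  constructor
  · exact Finset.measurable_prod (Finset.range M)
      (f := fun m (ω : PoissonSpace) => cellSign s S m (ω m))
      fun m _ => (cellSign_spec s S m).1.comp (measurable_pi_apply m)
  have h2 := integral_infinitePi_prod_range (fun _ : ℕ => (poissonMeasure 1).prod
    (Measure.infinitePi (fun _ : ℕ => (volume : Measure unitInterval))))
    (f := cellSign s S) (fun m => (cellSign_spec s S m).1) M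
  refine h2.trans ?_
  rw [Finset.prod_congr rfl fun m _ => (cellSign_spec s S m).2, ← Real.exp_sum,
    Finset.sum_sub_distrib, intervalIntegral.sum_integral_adjacent_intervals
    fun j _ => intervalIntegrable_signProd s S _ _]
  simp

instance : IsProbabilityMeasure poissonLaw := by unfold poissonLaw; infer_instance

lemma integrable_walsh_poissonOddSet {ι : Type*} [Fintype ι] [DecidableEq ι] (s : ι → ℝ)
    (S : Finset ι) : Integrable (fun ω => walsh S (poissonOddSet s ω)) poissonLaw := by
  have hM : ∀ k, ⌊s k⌋₊ + 1 ≤ (∑ k, (⌊s k⌋₊ + 1)) := fun k =>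
    Finset.single_le_sum (f := fun k => ⌊s k⌋₊ + 1) (fun _ _ => Nat.zero_le _) (Finset.mem_univ k)
  refine Integrable.of_bound (C := 1) (integral_walsh_poissonOddSet hM S).1.aestronglyMeasurable
    (Eventually.of_forall fun ω => ?_)
  rw [Real.norm_eq_abs, walsh, abs_prod_ite_neg_one]

/-- Beyond `u` the sign is identically 1 because `t k ≤ 1`, so that stretch cancels against `M`; the
rest is a change of scale. This matches the exponent found for Bernoulli trials. -/
lemma integral_signProd_scale {ι : Type*} (t : ι → ℝ) (ht : ∀ k, t k ≤ 1) (S : Finset ι) {u : ℝ}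
    (hu : 0 < u) {M : ℝ} (hM : u ≤ M) :
    (∫ x in (0 : ℝ)..M, signProd (fun k => t k * u) S x) - M
      = u * ((∫ x in (0 : ℝ)..1, signProd t S x) - 1) := by
  rw [← intervalIntegral.integral_add_adjacent_intervals
    (intervalIntegrable_signProd _ S 0 u) (intervalIntegrable_signProd _ S u M)]
  have h1 : ∫ x in u..M, signProd (fun k => t k * u) S x = M - u := by
    rw [intervalIntegral.integral_congr_ae (g := fun _ => (1 : ℝ))]
    · simp
    · refine Eventually.of_forall fun x hx => ?_
      rw [Set.uIoc_of_le hM] at hx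
      refine Finset.prod_eq_one fun k _ => if_neg ?_
      rw [not_le]
      nlinarith [hx.1, ht k]
  have h2 : ∫ x in (0 : ℝ)..u, signProd (fun k => t k * u) S x
      = u * ∫ x in (0 : ℝ)..1, signProd t S x := by
    have h3 : ∀ x, signProd (fun k => t k * u) S x = signProd t S (x / u) := fun x => by
      simp only [signProd, div_le_iff₀ hu]
    simp_rw [h3]
    rw [intervalIntegral.integral_comp_div (fun x => signProd t S x) hu.ne']
    simp [hu.ne']
  rw [h1, h2]; ring

/-- The parities of the Bernoulli counting processes converge in law to those of the Poisson
process. -/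
lemma tendsto_bernoulliExp_oddSet {ι : Type*} [Fintype ι] (t : ι → ℝ)
    (ht : ∀ k, t k ≤ 1) {u : ℝ} (hu : 0 < u) (F : Finset ι → ℝ) :
    Tendsto (fun n : ℕ => bernoulliExp n (u / n)
        (fun E => F (oddSet (fun k => ⌊(n : ℝ) * t k⌋₊) E))) atTop
      (𝓝 (∫ ω, F (poissonOddSet (fun k => t k * u) ω) ∂poissonLaw)) := by
  classical
  obtain ⟨c, hc⟩ := exists_eq_sum_walsh F
  simp_rw [hc, bernoulliExp_sum]
  rw [integral_finsetSum _ fun S _ => (integrable_walsh_poissonOddSet _ S).const_mul _]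
  simp_rw [integral_const_mul]
  refine tendsto_finsetSum _ fun S _ => Tendsto.const_mul _ ?_
  have hM : ∀ k, ⌊t k * u⌋₊ + 1 ≤ ⌊u⌋₊ + 1 := fun k =>
    Nat.succ_le_succ (Nat.floor_mono (by nlinarith [ht k]))
  rw [(integral_walsh_poissonOddSet hM S).2, integral_signProd_scale t ht S hu
    (by push_cast; exact (Nat.lt_floor_add_one u).le)]
  exact tendsto_bernoulliExp_walsh t S hu

/-! ### The characteristic function of one copy. -/

/-- Every success flips the parity and contributes `-1` when the count becomes odd, `+1` when it
becomes even, so the partial sums alternate between `-1` and `0`. -/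
lemma sum_neg_one_pow_mul (e : ℕ → ℕ) (N : ℕ) (he : ∀ j < N, e j = 0 ∨ e j = 1) :
    ∑ j ∈ Finset.range N, (-1 : ℝ) ^ (∑ k ∈ Finset.range (j + 1), e k) * (e j : ℝ)
      = -(if Odd (∑ k ∈ Finset.range N, e k) then 1 else 0) := by
  induction N with
  | zero => simp
  | succ N ih =>
    rw [Finset.sum_range_succ, ih fun j hj => he j (Nat.lt_succ_of_lt hj)]
    rw [Finset.sum_range_succ _ N]
    rcases he N (Nat.lt_succ_self N) with h | h
    · simp [h]
    · rw [h]
      by_cases ho : Odd (∑ k ∈ Finset.range N, e k)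
      · have h2 : Even (∑ k ∈ Finset.range N, e k + 1) := ho.add_one
        rw [if_pos ho, if_neg (Nat.not_odd_iff_even.2 h2), h2.neg_one_pow]
        norm_num
      · have h2 : Odd (∑ k ∈ Finset.range N, e k + 1) := (Nat.not_odd_iff_even.1 ho).add_one
        rw [if_neg ho, if_pos h2, h2.neg_one_pow]
        norm_num

/-- The set of `j < n` with `e j = 1`. -/
def successSet (n : ℕ) (e : ℕ → ℕ) : Finset ℕ := (Finset.range n).filter fun j => e j = 1

lemma card_successSet_inter {n N : ℕ} (hN : N ≤ n) {e : ℕ → ℕ} (he : ∀ j < n, e j = 0 ∨ e j = 1) :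
    (successSet n e ∩ Finset.range N).card = ∑ k ∈ Finset.range N, e k := by
  have h1 : successSet n e ∩ Finset.range N = (Finset.range N).filter fun j => e j = 1 := by
    ext j
    simp only [successSet, Finset.mem_inter, Finset.mem_filter, Finset.mem_range]
    constructor
    · rintro ⟨⟨_, a⟩, b⟩; exact ⟨b, a⟩
    · rintro ⟨a, b⟩; exact ⟨⟨a.trans_le hN, b⟩, a⟩
  rw [h1, Finset.card_filter]
  refine Finset.sum_congr rfl fun j hj => ?_
  rcases he j ((Finset.mem_range.1 hj).trans_le hN) with h | h <;> simp [h]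

/-- The events indexed by `E` are disjoint and their union is the event that the first `n` values
lie in `{0, 1}`. The indicator on the right is needed because `η` is only `ℕ`-valued. -/
lemma sum_indicator_powerset {Ω : Type*} {η : ℕ → Ω → ℕ} (n : ℕ) (F : Finset ℕ → ℝ) (ω : Ω) :
    ∑ E ∈ (Finset.range n).powerset,
        F E * {ω | ∀ j < n, η j ω = if j ∈ E then 1 else 0}.indicator (fun _ => (1 : ℝ)) ω
      = {ω | ∀ j < n, η j ω = 0 ∨ η j ω = 1}.indicator (fun _ => (1 : ℝ)) ω
          * F (successSet n fun j => η j ω) := by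
  by_cases h : ∀ j < n, η j ω = 0 ∨ η j ω = 1
  · rw [Set.indicator_of_mem (by exact h), one_mul]
    rw [Finset.sum_eq_single (successSet n fun j => η j ω)]
    · rw [Set.indicator_of_mem, mul_one]
      intro j hj
      rcases h j hj with h1 | h1 <;> simp [successSet, h1, hj]
    · intro E hE hne
      rw [Set.indicator_of_notMem, mul_zero]
      intro hmem
      refine hne (Finset.ext fun j => ?_)
      simp only [successSet, Finset.mem_filter, Finset.mem_range]
      constructor
      · intro hj
        have hjn := Finset.mem_range.1 (Finset.mem_powerset.1 hE hj)
        exact ⟨hjn, by simpa [hj] using hmem j hjn⟩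
      · rintro ⟨hjn, hj⟩
        by_contra hj'
        have := hmem j hjn
        simp [hj', hj] at this
    · intro h'
      exact absurd (Finset.mem_powerset.2 (Finset.filter_subset _ _)) h'
  · rw [Set.indicator_of_notMem (by exact h), zero_mul]
    refine Finset.sum_eq_zero fun E _ => ?_
    rw [Set.indicator_of_notMem, mul_zero]
    intro hmem
    refine h fun j hj => ?_
    rw [hmem j hj]
    split_ifs <;> simp

section BaseModel

variable {Ω : Type*} [MeasurableSpace Ω] {P : Measure Ω} [IsProbabilityMeasure P]
  {q : Ω → ℝ} {η : ℕ → Ω → ℕ}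

/-- The bounded factor `g (q ω)` is pulled out of the conditional expectation given `q`. The second
integrability claim holds because that function is a version of a conditional expectation. -/
lemma IsCondIIDBernoulli.integral_cell (hq : Measurable q) (hη : IsCondIIDBernoulli q η P) (n : ℕ)
    (E : Finset ℕ) {g : ℝ → ℝ} (hg : Measurable g) {c : ℝ} (hgc : ∀ x, |g x| ≤ c) :
    Integrable (fun ω => g (q ω) *
        {ω | ∀ j < n, η j ω = if j ∈ E then 1 else 0}.indicator (fun _ => (1 : ℝ)) ω) P ∧
    Integrable (fun ω => g (q ω) * ∏ j ∈ Finset.range n, if j ∈ E then q ω else 1 - q ω) P ∧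
    ∫ ω, g (q ω) * {ω | ∀ j < n, η j ω = if j ∈ E then 1 else 0}.indicator (fun _ => (1 : ℝ)) ω ∂P
      = ∫ ω, g (q ω) * ∏ j ∈ Finset.range n, (if j ∈ E then q ω else 1 - q ω) ∂P := by
  set A := {ω | ∀ j < n, η j ω = if j ∈ E then 1 else 0} with hA
  have hAm : MeasurableSet A := by
    have : A = ⋂ j ∈ Finset.range n, {ω | η j ω = if j ∈ E then 1 else 0} := by
      ext ω; simp [hA]
    rw [this]
    exact Finset.measurableSet_biInter _ fun j _ => hη.measurable j (measurableSet_singleton _)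
  have h1 := hη.condProb n (fun j => if j ∈ E then 1 else 0) fun j => by
    by_cases h : j ∈ E <;> simp [h]
  have h1' : P[A.indicator (fun _ => (1 : ℝ)) | MeasurableSpace.comap q inferInstance]
      =ᵐ[P] fun ω => ∏ j ∈ Finset.range n, (if j ∈ E then q ω else 1 - q ω) := by
    refine h1.trans (Eventually.of_forall fun ω => ?_)
    refine Finset.prod_congr rfl fun j _ => ?_
    by_cases h : j ∈ E <;> simp [h]
  have hi1 : Integrable (A.indicator (fun _ => (1 : ℝ))) P := (integrable_const _).indicator hAm
  have hb : ∀ᵐ ω ∂P, ‖g (q ω)‖ ≤ c := Eventually.of_forall fun ω => hgc _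
  have hi2 : Integrable ((fun ω => g (q ω)) * A.indicator (fun _ => (1 : ℝ))) P :=
    hi1.bdd_mul (hg.comp hq).aestronglyMeasurable hb
  have h2 := condExp_mul_of_stronglyMeasurable_left (m := MeasurableSpace.comap q inferInstance)
    (f := fun ω => g (q ω)) (g := A.indicator (fun _ => (1 : ℝ))) (μ := P)
    ((hg.comp (comap_measurable q)).stronglyMeasurable) hi2 hi1
  have h3 : P[(fun ω => g (q ω)) * A.indicator (fun _ => (1 : ℝ)) |
      MeasurableSpace.comap q inferInstance] =ᵐ[P]
      fun ω => g (q ω) * ∏ j ∈ Finset.range n, (if j ∈ E then q ω else 1 - q ω) := by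
    filter_upwards [h2, h1'] with ω e1 e2
    rw [e1, Pi.mul_apply, e2]
  refine ⟨hi2, integrable_condExp.congr h3, ?_⟩
  rw [← integral_congr_ae h3, integral_condExp hq.comap_le]
  rfl

/-- The conditional probabilities of the 0-1 patterns add up to one, so these patterns exhaust the
space up to a null set. -/
lemma IsCondIIDBernoulli.ae_zero_or_one (hq : Measurable q) (hη : IsCondIIDBernoulli q η P)
    (n : ℕ) : ∀ᵐ ω ∂P, ∀ j < n, η j ω = 0 ∨ η j ω = 1 := by
  set B := {ω | ∀ j < n, η j ω = 0 ∨ η j ω = 1}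
  have hBm : MeasurableSet B := by
    have : B = ⋂ j ∈ Finset.range n, {ω | η j ω = 0 ∨ η j ω = 1} := by
      ext ω; simp [B]
    rw [this]
    refine Finset.measurableSet_biInter _ fun j _ => ?_
    exact hη.measurable j (MeasurableSet.of_discrete (s := {k : ℕ | k = 0 ∨ k = 1}))
  have hc := fun E => hη.integral_cell hq n E (g := fun _ => 1) measurable_const (c := 1) (by simp)
  have h1 : ∫ ω, B.indicator (fun _ => (1 : ℝ)) ω ∂P = 1 := by
    have e1 : ∀ ω, B.indicator (fun _ => (1 : ℝ)) ω = ∑ E ∈ (Finset.range n).powerset,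
        1 * {ω | ∀ j < n, η j ω = if j ∈ E then 1 else 0}.indicator (fun _ => (1 : ℝ)) ω := by
      intro ω
      rw [sum_indicator_powerset n (fun _ => 1) ω, mul_one]
    simp_rw [e1]
    rw [integral_finsetSum _ fun E _ => (hc E).1]
    simp_rw [fun E => (hc E).2.2]
    rw [← integral_finsetSum _ fun E _ => (hc E).2.1]
    have e2 : ∀ ω, ∑ E ∈ (Finset.range n).powerset,
        1 * ∏ j ∈ Finset.range n, (if j ∈ E then q ω else 1 - q ω) = 1 := by
      intro ω
      have := bernoulliExp_one n (q ω)
      simpa [bernoulliExp] using this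
    simp_rw [e2]
    simp
  rw [integral_indicator_const _ hBm, smul_eq_mul, mul_one] at h1
  have h2 : P B = 1 := by
    have := ENNReal.ofReal_toReal (measure_ne_top P B)
    rw [← this, ← measureReal_def, h1, ENNReal.ofReal_one]
  exact (prob_compl_eq_zero_iff hBm).2 h2

/-- Integration of functions of `q` and `η 0, …, η (n-1)`. -/
lemma IsCondIIDBernoulli.integral_comp (hq : Measurable q) (hη : IsCondIIDBernoulli q η P)
    (n : ℕ) {F : ℝ → Finset ℕ → ℝ} (hF : ∀ E, Measurable fun x => F x E) {c : ℝ}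
    (hc : ∀ x E, |F x E| ≤ c) :
    ∫ ω, F (q ω) (successSet n fun j => η j ω) ∂P
      = ∫ x, bernoulliExp n x (F x) ∂(P.map q) := by
  have hcell := fun E => hη.integral_cell hq n E (hF E) (fun x => hc x E)
  have h1 : ∫ ω, F (q ω) (successSet n fun j => η j ω) ∂P
      = ∫ ω, ∑ E ∈ (Finset.range n).powerset, F (q ω) E *
        {ω | ∀ j < n, η j ω = if j ∈ E then 1 else 0}.indicator (fun _ => (1 : ℝ)) ω ∂P := by
    refine integral_congr_ae ?_
    filter_upwards [hη.ae_zero_or_one hq n] with ω hω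
    rw [sum_indicator_powerset n (F (q ω)) ω, Set.indicator_of_mem (by exact hω), one_mul]
  rw [h1, integral_finsetSum _ fun E _ => (hcell E).1]
  simp_rw [fun E => (hcell E).2.2]
  rw [← integral_finsetSum _ fun E _ => (hcell E).2.1, integral_map hq.aemeasurable]
  · refine integral_congr_ae (Eventually.of_forall fun ω => ?_)
    simp only [bernoulliExp]
    exact Finset.sum_congr rfl fun E _ => mul_comm _ _
  · refine (Finset.measurable_sum _ fun E _ => Measurable.mul ?_ (hF E)).aestronglyMeasurable
    refine Finset.measurable_prod _ fun j _ => ?_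
    split_ifs <;> fun_prop

variable {X : Ω → ℝ}

/-- For symmetric `X`, the characteristic function is real. -/
lemma integral_cexp_of_symmetric (hX : Measurable X) (hs : IdentDistrib X (fun ω => -X ω) P P)
    (s : ℝ) : ∫ ω, Complex.exp (Complex.I * ((X ω * s : ℝ) : ℂ)) ∂P
      = ((1 - ∫ ω, (1 - Real.cos (s * X ω)) ∂P : ℝ) : ℂ) := by
  have h1 : ∀ ω, Complex.exp (Complex.I * ((X ω * s : ℝ) : ℂ))
      = ((Real.cos (s * X ω) : ℝ) : ℂ) + ((Real.sin (s * X ω) : ℝ) : ℂ) * Complex.I := by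
    intro ω
    rw [mul_comm, Complex.exp_mul_I, mul_comm (X ω) s, Complex.ofReal_cos, Complex.ofReal_sin]
  have hc : Integrable (fun ω => Real.cos (s * X ω)) P :=
    Integrable.of_bound (C := 1) (by fun_prop)
      (Eventually.of_forall fun ω => Real.abs_cos_le_one _)
  have hsin : Integrable (fun ω => Real.sin (s * X ω)) P :=
    Integrable.of_bound (C := 1) (by fun_prop)
      (Eventually.of_forall fun ω => Real.abs_sin_le_one _)
  have h2 : ∫ ω, Real.sin (s * X ω) ∂P = 0 := by
    have h3 := (hs.comp (u := fun x => Real.sin (s * x)) (by fun_prop)).integral_eq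
    simp only [Function.comp_def, mul_neg, Real.sin_neg, integral_neg] at h3
    linarith
  simp_rw [h1]
  rw [integral_add hc.ofReal (hsin.ofReal.mul_const _), integral_mul_const,
    integral_complex_ofReal, integral_complex_ofReal, h2, integral_sub (integrable_const _) hc]
  simp

lemma measurable_integral_one_sub_cos (hX : Measurable X) :
    Measurable fun s : ℝ => ∫ ω, (1 - Real.cos (s * X ω)) ∂P := by
  have : StronglyMeasurable (fun p : ℝ × Ω => 1 - Real.cos (p.1 * X p.2)) :=
    Measurable.stronglyMeasurable (by fun_prop)
  exact this.integral_prod_right'.measurable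

/-- The characteristic function of one aggregated copy. -/
lemma IsBaseModel.integral_cexp {ρ : ℝ} {L : ℝ → ℝ} (hmodel : IsBaseModel ρ L X q η P)
    {ι : Type*} [Fintype ι] [DecidableEq ι] (α' a : ℝ) (θ : ι → ℝ) (n : ℕ) (N : ι → ℕ)
    (hN : ∀ k, N k ≤ n) :
    ∫ ω, Complex.exp (Complex.I * ((∑ k, θ k *
        ((∑ j ∈ Finset.range (N k), modelVar α' X q η j ω) / a) : ℝ) : ℂ)) ∂P
      = ((1 - ∫ x, bernoulliExp n x (fun E => ∫ ω, (1 - Real.cos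
          ((1 / x ^ (1 / α') / a * ∑ k, θ k * (if k ∈ oddSet N E then 1 else 0)) * X ω)) ∂P)
          ∂(parameterLaw ρ L) : ℝ) : ℂ) := by
  have hX := hmodel.measurable_X
  have hq := hmodel.measurable_q
  have hη := hmodel.bernoulli
  set h : ℝ → ℝ := fun s => ∫ ω, (1 - Real.cos (s * X ω)) ∂P with hh
  have hhm : Measurable h := measurable_integral_one_sub_cos hX
  -- The linear combination factors as `X * ζ (q, η)`, so `X` can be integrated out first by
  -- independence.
  set ζ : ℝ × (ℕ → ℕ) → ℝ := fun w => 1 / w.1 ^ (1 / α') / a * ∑ k, θ k *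
    ∑ j ∈ Finset.range (N k), (-1 : ℝ) ^ (∑ i ∈ Finset.range (j + 1), w.2 i) * (w.2 j : ℝ) with hζ
  have hζm : Measurable ζ := by
    have hw : ∀ j, Measurable fun w : ℝ × (ℕ → ℕ) => w.2 j := fun j => by fun_prop
    have hw' : ∀ j, Measurable fun w : ℝ × (ℕ → ℕ) => (w.2 j : ℝ) := fun j =>
      (measurable_from_top (f := fun k : ℕ => (k : ℝ))).comp (hw j)
    have hp : ∀ j, Measurable fun w : ℝ × (ℕ → ℕ) =>
        (-1 : ℝ) ^ (∑ i ∈ Finset.range (j + 1), w.2 i) := fun j =>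
      (measurable_from_top (f := fun k : ℕ => (-1 : ℝ) ^ k)).comp
        (Finset.measurable_sum _ fun i _ => hw i)
    refine Measurable.mul (by fun_prop) (Finset.measurable_sum _ fun k _ => ?_)
    exact (Finset.measurable_sum _ fun j _ => (hp j).mul (hw' j)).const_mul _
  set W : Ω → ℝ × (ℕ → ℕ) := fun ω => (q ω, fun j => η j ω) with hW
  have hWm : Measurable W := hq.prodMk (measurable_pi_lambda _ hη.measurable)
  have hV : ∀ ω, ∑ k, θ k * ((∑ j ∈ Finset.range (N k), modelVar α' X q η j ω) / a)
      = X ω * ζ (W ω) := by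
    intro ω
    simp only [hζ, hW, modelVar]
    rw [Finset.mul_sum, Finset.mul_sum]
    refine Finset.sum_congr rfl fun k _ => ?_
    simp_rw [mul_assoc (X ω / q ω ^ (1 / α'))]
    rw [← Finset.mul_sum]
    ring
  simp_rw [hV]
  have hmap := (indepFun_iff_map_prod_eq_prod_map_map hX.aemeasurable hWm.aemeasurable).1
    hmodel.indep
  set G : ℝ × (ℝ × (ℕ → ℕ)) → ℂ := fun p => Complex.exp (Complex.I * ((p.1 * ζ p.2 : ℝ) : ℂ))
  have hGm : Measurable G := by
    have : Measurable fun p : ℝ × (ℝ × (ℕ → ℕ)) => p.1 * ζ p.2 :=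
      measurable_fst.mul (hζm.comp measurable_snd)
    fun_prop
  have := Measure.isProbabilityMeasure_map (μ := P) hX.aemeasurable
  have := Measure.isProbabilityMeasure_map (μ := P) hWm.aemeasurable
  have h1 : ∫ ω, Complex.exp (Complex.I * ((X ω * ζ (W ω) : ℝ) : ℂ)) ∂P
      = ∫ p, G p ∂(P.map fun ω => (X ω, W ω)) := by
    rw [integral_map (hX.prodMk hWm).aemeasurable hGm.aestronglyMeasurable]
  rw [h1, hmap, integral_prod_symm]
  swap
  · refine Integrable.of_bound (C := 1) hGm.aestronglyMeasurable
      (Eventually.of_forall fun p => ?_)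
    simp only [G]
    rw [mul_comm, Complex.norm_exp_ofReal_mul_I]
  have h2 : ∀ w, ∫ x, G (x, w) ∂(P.map X) = ((1 - h (ζ w) : ℝ) : ℂ) := by
    intro w
    have hGw : Measurable fun x => G (x, w) := hGm.comp (measurable_id.prodMk measurable_const)
    rw [integral_map hX.aemeasurable hGw.aestronglyMeasurable]
    exact integral_cexp_of_symmetric hX hmodel.symmetric (ζ w)
  simp_rw [h2]
  have hhζ : Measurable fun w => 1 - h (ζ w) := measurable_const.sub (hhm.comp hζm)
  rw [integral_complex_ofReal, integral_map hWm.aemeasurable hhζ.aestronglyMeasurable]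
  congr 1
  have hhb : ∀ s, |h s| ≤ 2 := fun s => by
    rw [abs_of_nonneg (integral_one_sub_cos_nonneg s)]
    exact integral_one_sub_cos_le_two s
  have h3 : ∫ ω, (1 - h (ζ (W ω))) ∂P = 1 - ∫ ω, h (ζ (W ω)) ∂P := by
    have hi : Integrable (fun ω => h (ζ (W ω))) P :=
      Integrable.of_bound (C := 2) (hhm.comp (hζm.comp hWm)).aestronglyMeasurable
        (Eventually.of_forall fun ω => hhb _)
    rw [integral_sub (integrable_const _) hi]
    simp
  rw [h3]
  congr 1
  rw [← hmodel.law_q, ← hη.integral_comp hq n (F := fun x E => h (1 / x ^ (1 / α') / a *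
    ∑ k, θ k * (if k ∈ oddSet N E then 1 else 0))) (c := 2)
    (fun E => hhm.comp (by fun_prop)) (fun x E => hhb _)]
  refine integral_congr_ae ?_
  filter_upwards [hη.ae_zero_or_one hq n] with ω hω
  -- The telescoped sum carries a minus sign, which disappears since the cosine is even.
  have h4 : ζ (W ω) = -(1 / q ω ^ (1 / α') / a *
      ∑ k, θ k * (if k ∈ oddSet N (successSet n fun j => η j ω) then 1 else 0)) := by
    simp only [hζ, hW]
    rw [← mul_neg, ← Finset.sum_neg_distrib]
    congr 1
    refine Finset.sum_congr rfl fun k _ => ?_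
    rw [sum_neg_one_pow_mul _ _ fun j hj => hω j (hj.trans_le (hN k)), ← mul_neg]
    congr 2
    simp only [oddSet, Finset.mem_filter, Finset.mem_univ, true_and]
    rw [card_successSet_inter (hN k) hω]
  rw [h4]
  simp only [hh]
  rw [← integral_one_sub_cos_abs, abs_neg, integral_one_sub_cos_abs]

end BaseModel

/-! ### Asymptotics of the exponent under the scaling `x = u / n`. -/

/-- The weighted sum `∑_{k ∈ A} θ k`. -/
def weightSum {ι : Type*} [Fintype ι] [DecidableEq ι] (θ : ι → ℝ) (A : Finset ι) : ℝ :=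
  ∑ k, θ k * (if k ∈ A then 1 else 0)

lemma weightSum_empty {ι : Type*} [Fintype ι] [DecidableEq ι] (θ : ι → ℝ) :
    weightSum θ ∅ = 0 := by simp [weightSum]

lemma abs_weightSum_le {ι : Type*} [Fintype ι] [DecidableEq ι] (θ : ι → ℝ) (A : Finset ι) :
    |weightSum θ A| ≤ ∑ k, |θ k| := by
  refine (Finset.abs_sum_le_sum_abs _ _).trans (Finset.sum_le_sum fun k _ => ?_)
  split_ifs <;> simp

/-- Near zero the function is `u ^ (-β)`, which needs `β < 1`; at infinity it is `u ^ (-β - 1)`,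
which needs `β > 0`. -/
lemma integrableOn_min_one_mul_rpow {β : ℝ} (h0 : 0 < β) (h1 : β < 1) :
    IntegrableOn (fun u : ℝ => min 1 u * u ^ (-β - 1)) (Set.Ioi 0) := by
  rw [← Set.Ioc_union_Ioi_eq_Ioi zero_le_one]
  refine IntegrableOn.union ?_ ?_
  · have h2 : IntegrableOn (fun u : ℝ => u ^ (-β)) (Set.Ioc 0 1) :=
      (intervalIntegral.intervalIntegrable_rpow' (by linarith)).1
    refine h2.congr_fun (fun u hu => ?_) measurableSet_Ioc
    have hu0 : 0 < u := hu.1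
    simp only [min_eq_right hu.2]
    rw [show -β = 1 + (-β - 1) by ring, Real.rpow_add hu0, Real.rpow_one]
    congr 2; ring
  · refine (integrableOn_Ioi_rpow_of_lt (a := -β - 1) (by linarith) one_pos).congr_fun
      (fun u hu => ?_) measurableSet_Ioi
    simp only [min_eq_left (le_of_lt (Set.mem_Ioi.1 hu)), one_mul]

section Limit

variable {ι : Type*} [Fintype ι] [DecidableEq ι]

lemma integrable_comp_poissonOddSet (s : ι → ℝ) (F : Finset ι → ℝ) :
    Integrable (fun ω => F (poissonOddSet s ω)) poissonLaw := by
  obtain ⟨c, hc⟩ := exists_eq_sum_walsh F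
  simp_rw [hc]
  exact integrable_finsetSum _ fun S _ => (integrable_walsh_poissonOddSet s S).const_mul _

/-- There are finitely many subsets `B`, so a functional depending on `n` splits into its values
times the probabilities of the events `A = B`, and both converge. -/
lemma tendsto_bernoulliExp_of_tendsto {t : ι → ℝ} (ht : ∀ k, t k ≤ 1) {u : ℝ} (hu : 0 < u)
    {G : ℕ → Finset ι → ℝ} {F : Finset ι → ℝ}
    (hG : ∀ B, Tendsto (fun n => G n B) atTop (𝓝 (F B))) :
    Tendsto (fun n : ℕ => bernoulliExp n (u / n)
        (fun E => G n (oddSet (fun k => ⌊(n : ℝ) * t k⌋₊) E))) atTop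
      (𝓝 (∫ ω, F (poissonOddSet (fun k => t k * u) ω) ∂poissonLaw)) := by
  have h1 : ∀ (g : Finset ι → ℝ) A, g A = ∑ B, g B * (if A = B then 1 else 0) := by
    intro g A; simp
  rw [integral_congr_ae (Eventually.of_forall fun ω => h1 F _),
    integral_finsetSum _ fun B _ =>
      (integrable_comp_poissonOddSet _ fun A => if A = B then (1 : ℝ) else 0).const_mul _]
  simp_rw [integral_const_mul]
  have h2 : ∀ n : ℕ, bernoulliExp n (u / n)
        (fun E => G n (oddSet (fun k => ⌊(n : ℝ) * t k⌋₊) E))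
      = ∑ B, G n B * bernoulliExp n (u / n)
        (fun E => if oddSet (fun k => ⌊(n : ℝ) * t k⌋₊) E = B then 1 else 0) := by
    intro n
    rw [← bernoulliExp_sum]
    exact bernoulliExp_congr fun E _ => h1 _ _
  simp_rw [h2]
  exact tendsto_finsetSum _ fun B _ => (hG B).mul
    (tendsto_bernoulliExp_oddSet t ht hu fun A => if A = B then 1 else 0)

variable {α K D : ℝ} {h : ℝ → ℝ}

/-- Without a success the weight is zero and so is the bound on `h`. Otherwise the weight is at most
`∑ k, |θ k|`, and this has probability at most `min 1 (n p)`. -/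
lemma bernoulliExp_symbol_le (hα : 0 < α) (hK0 : 0 ≤ K) (hK : ∀ s, h s ≤ K * |s| ^ α)
    (θ : ι → ℝ) {n : ℕ} {p : ℝ} (h0 : 0 ≤ p) (h1 : p ≤ 1) (N : ι → ℕ) {b : ℝ} (hb : 0 ≤ b) :
    bernoulliExp n p (fun E => h (b * weightSum θ (oddSet N E)))
      ≤ b ^ α * (K * (∑ k, |θ k|) ^ α * min 1 (n * p)) := by
  have hΘ : 0 ≤ ∑ k, |θ k| := Finset.sum_nonneg fun _ _ => abs_nonneg _
  calc _ ≤ bernoulliExp n p (fun E => (b ^ α * (K * (∑ k, |θ k|) ^ α)) *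
        (if E = ∅ then 0 else 1)) := by
        refine bernoulliExp_mono h0 h1 fun E _ => (hK _).trans ?_
        split_ifs with hE
        · simp [hE, oddSet_empty, weightSum_empty, hα.ne']
        · rw [abs_mul, abs_of_nonneg hb, Real.mul_rpow hb (abs_nonneg _), mul_one, mul_left_comm]
          have := Real.rpow_le_rpow (abs_nonneg _) (abs_weightSum_le θ (oddSet N E)) hα.le
          gcongr
    _ ≤ _ := by
      rw [bernoulliExp_const_mul, ← mul_assoc (b ^ α) (K * (∑ k, |θ k|) ^ α)]
      exact mul_le_mul_of_nonneg_left (bernoulliExp_nonempty_le h1) (by positivity)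

lemma tendsto_symbol_scaled (hα : 0 < α) (h00 : h 0 = 0)
    (hD : Tendsto (fun s => h s / |s| ^ α) (𝓝[≠] 0) (𝓝 D)) {b : ℕ → ℝ}
    (hb0 : ∀ᶠ n in atTop, 0 < b n) (hb : Tendsto b atTop (𝓝 0)) (y : ℝ) :
    Tendsto (fun n => h (b n * y) / b n ^ α) atTop (𝓝 (D * |y| ^ α)) := by
  rcases eq_or_ne y 0 with rfl | hy
  · simp [h00, hα.ne']
  have h1 : Tendsto (fun n => b n * y) atTop (𝓝[≠] 0) := by
    refine tendsto_nhdsWithin_iff.2 ⟨by simpa using hb.mul_const y, ?_⟩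
    filter_upwards [hb0] with n hn
    exact mul_ne_zero hn.ne' hy
  have h2 := (hD.comp h1).mul_const (|y| ^ α)
  refine h2.congr' ?_
  filter_upwards [hb0] with n hn
  have : 0 < |y| ^ α := Real.rpow_pos_of_pos (abs_pos.2 hy) _
  have h3 : 0 < b n ^ α := Real.rpow_pos_of_pos hn _
  simp only [Function.comp]
  rw [abs_mul, abs_of_pos hn, Real.mul_rpow hn.le (abs_nonneg _)]
  field_simp

lemma tendsto_bernoulliExp_symbol (hα : 0 < α) (h00 : h 0 = 0)
    (hD : Tendsto (fun s => h s / |s| ^ α) (𝓝[≠] 0) (𝓝 D)) {t : ι → ℝ} (ht : ∀ k, t k ≤ 1)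
    (θ : ι → ℝ) {u : ℝ} (hu : 0 < u) {b : ℕ → ℝ}
    (hb0 : ∀ᶠ n in atTop, 0 < b n) (hb : Tendsto b atTop (𝓝 0)) :
    Tendsto (fun n : ℕ => bernoulliExp n (u / n) (fun E =>
        h (b n * weightSum θ (oddSet (fun k => ⌊(n : ℝ) * t k⌋₊) E))) / b n ^ α) atTop
      (𝓝 (D * ∫ ω, |weightSum θ (poissonOddSet (fun k => t k * u) ω)| ^ α ∂poissonLaw)) := by
  rw [← integral_const_mul]
  refine (tendsto_bernoulliExp_of_tendsto ht hu (F := fun A => D * |weightSum θ A| ^ α)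
    (G := fun n A => (b n ^ α)⁻¹ * h (b n * weightSum θ A)) fun B => ?_).congr fun n => ?_
  · simp_rw [inv_mul_eq_div]
    exact tendsto_symbol_scaled hα h00 hD hb0 hb _
  · rw [bernoulliExp_const_mul, inv_mul_eq_div]

/-- The Bernoulli bound for the symbol `|s| ^ α` passes to the limit, so no estimate on the Poisson
side is needed. -/
lemma integral_abs_weightSum_rpow_le (hα : 0 < α) {t : ι → ℝ} (ht : ∀ k, t k ≤ 1)
    (θ : ι → ℝ) {u : ℝ} (hu : 0 < u) :
    ∫ ω, |weightSum θ (poissonOddSet (fun k => t k * u) ω)| ^ α ∂poissonLaw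
      ≤ (∑ k, |θ k|) ^ α * min 1 u := by
  refine le_of_tendsto
    (tendsto_bernoulliExp_oddSet t ht hu (fun A => |weightSum θ A| ^ α)) ?_
  obtain ⟨m, hm⟩ := exists_nat_gt u
  filter_upwards [eventually_ge_atTop m] with n hn
  have hn' : u < n := hm.trans_le (by exact_mod_cast hn)
  have hn0 : (0 : ℝ) < n := hu.trans hn'
  have h1 := bernoulliExp_symbol_le (h := fun s => |s| ^ α) (K := 1) hα zero_le_one (by simp) θ
    (n := n) (p := u / n) (by positivity) ((div_le_one hn0).2 hn'.le)
    (fun k => ⌊(n : ℝ) * t k⌋₊) zero_le_one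
  simp only [one_mul, Real.one_rpow] at h1
  rwa [mul_div_cancel₀ _ hn0.ne'] at h1

/-- The contribution of small parameters, rescaled. -/
lemma tendsto_integral_small_parameters {ρ α' β c : ℝ} {L : ℝ → ℝ} (hL : IsSlowlyVarying L)
    (hα : 0 < α) (hβ : β = α / α' - 1 + ρ) (hβ0 : 0 < β) (hβ1 : β < 1)
    (hc : 0 < c) (hm : Measurable h) (h00 : h 0 = 0) (h0 : ∀ s, 0 ≤ h s) (hK0 : 0 ≤ K)
    (hK : ∀ s, h s ≤ K * |s| ^ α)
    (hD : Tendsto (fun s => h s / |s| ^ α) (𝓝[≠] 0) (𝓝 D)) {m : ℕ → ℕ} (hm0 : ∀ n, 0 < m n)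
    (hmn : Tendsto (fun n : ℕ => (m n : ℝ) * L n / (n : ℝ) ^ (1 - ρ)) atTop atTop)
    {a : ℕ → ℝ}
    (ha : ∀ᶠ n : ℕ in atTop, 0 < a n ∧ a n ^ α = c * ((n : ℝ) ^ β * m n * L n))
    {t : ι → ℝ} (ht : ∀ k, t k ≤ 1) (θ : ι → ℝ) :
    ∃ r : ℝ, 0 < r ∧ r ≤ 1 ∧ Tendsto (fun n : ℕ => m n * ∫ x in Set.Ioo 0 r,
        bernoulliExp n x (fun E => h (1 / x ^ (1 / α') / a n *
          weightSum θ (oddSet (fun k => ⌊(n : ℝ) * t k⌋₊) E))) * (x ^ (-ρ) * L (1 / x))) atTop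
      (𝓝 (D / c * ∫ u in Set.Ioi 0,
        (∫ ω, |weightSum θ (poissonOddSet (fun k => t k * u) ω)| ^ α ∂poissonLaw)
          * u ^ (-β - 1))) := by
  -- Chosen so that `β - δ` and `β + δ` both stay in `(0, 1)`, leaving room for the two powers in
  -- Potter's bound.
  set δ := min β (1 - β) / 2 with hδ
  have hδ0 : 0 < δ := half_pos (lt_min hβ0 (by linarith))
  have hδ1 : δ < β := by have := min_le_left β (1 - β); linarith [hδ]
  have hδ2 : β + δ < 1 := by have := min_le_right β (1 - β); linarith [hδ]
  obtain ⟨x₀, hx₀, hpos, hP⟩ := hL.exists_potter hδ0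
  have hx₀0 : 0 < x₀ := by linarith
  -- For `x < 1 / x₀` the argument `1 / x` lies in the range of Potter's bound.
  refine ⟨1 / x₀, by positivity, (div_le_one hx₀0).2 hx₀, ?_⟩
  set r := 1 / x₀ with hr
  have hr0 : 0 < r := by positivity
  have hr1 : r ≤ 1 := (div_le_one hx₀0).2 hx₀
  set Θ := (∑ k, |θ k|) ^ α with hΘ
  have hΘ0 : 0 ≤ Θ := Real.rpow_nonneg (Finset.sum_nonneg fun _ _ => abs_nonneg _) _
  set H : ℕ → ℝ → ℝ := fun n x => bernoulliExp n x (fun E => h (1 / x ^ (1 / α') / a n *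
          weightSum θ (oddSet (fun k => ⌊(n : ℝ) * t k⌋₊) E))) with hH
  have hHm : ∀ n, Measurable (H n) := fun n => by
    refine Finset.measurable_sum _ fun E _ => Measurable.mul ?_ (hm.comp (by fun_prop))
    refine Finset.measurable_prod _ fun j _ => ?_
    split_ifs <;> fun_prop
  have hLm := hL.measurable
  set g : ℕ → ℝ → ℝ := fun n => (Set.Ioo 0 r).indicator
    (fun x => H n x * (x ^ (-ρ) * L (1 / x))) with hg
  have hgm : ∀ n, Measurable (g n) := fun n =>
    Measurable.indicator ((hHm n).mul (by fun_prop)) measurableSet_Ioo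
  set b : ℕ → ℝ → ℝ := fun n u => 1 / (u / n) ^ (1 / α') / a n with hb
  -- Two uses of `α / α' + ρ = β + 1`: `b n u ^ α` is a constant over the quantity assumed to
  -- diverge, and all prefactors reduce to `u ^ (-β - 1) / (c L n)`.
  have hscale : ∀ᶠ n : ℕ in atTop, ∀ u, 0 < u → 0 < b n u ∧ 0 < L n ∧
      b n u ^ α = u ^ (-(α / α')) / c * ((m n : ℝ) * L n / (n : ℝ) ^ (1 - ρ))⁻¹ ∧
      (m n : ℝ) * ((n : ℝ)⁻¹ * (b n u ^ α * (u / n) ^ (-ρ))) = u ^ (-β - 1) / (c * L n) := by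
    filter_upwards [ha, eventually_gt_atTop 0,
      tendsto_natCast_atTop_atTop.eventually hL.eventually_pos] with n ha hn hLn u hu
    have hn0 : (0 : ℝ) < n := by exact_mod_cast hn
    have hm0' : (0 : ℝ) < m n := by exact_mod_cast hm0 n
    have hbα : b n u ^ α = u ^ (-(α / α')) / c * ((m n : ℝ) * L n / (n : ℝ) ^ (1 - ρ))⁻¹ := by
      simp only [hb]
      rw [Real.div_rpow (by positivity) ha.1.le, ha.2, Real.div_rpow zero_le_one (by positivity),
        Real.one_rpow, ← Real.rpow_mul (by positivity), Real.div_rpow hu.le hn0.le,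
        Real.rpow_neg hu.le, show 1 / α' * α = α / α' by ring]
      have e1 : (n : ℝ) ^ (α / α') = (n : ℝ) ^ β * (n : ℝ) ^ (1 - ρ) := by
        rw [← Real.rpow_add hn0]; congr 1; rw [hβ]; ring
      rw [e1]
      field_simp
    refine ⟨div_pos (by positivity) ha.1, hLn, hbα, ?_⟩
    rw [hbα, Real.div_rpow hu.le hn0.le]
    have e2 : u ^ (-β - 1) = u ^ (-(α / α')) * u ^ (-ρ) := by
      rw [← Real.rpow_add hu]; congr 1; rw [hβ]; ring
    have e3 : (n : ℝ) ^ (1 - ρ) = n * (n : ℝ) ^ (-ρ) := by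
      rw [sub_eq_add_neg, Real.rpow_add hn0, Real.rpow_one]
    rw [e2, e3]
    field_simp
  have hsub : ∀ᶠ n : ℕ in atTop, m n * ∫ x in Set.Ioo 0 r, H n x * (x ^ (-ρ) * L (1 / x))
      = ∫ u in Set.Ioi 0, m n * ((n : ℝ)⁻¹ * g n (u / n)) := by
    filter_upwards [eventually_gt_atTop 0] with n hn
    have hn0 : (0 : ℝ) < n := by exact_mod_cast hn
    rw [integral_const_mul, integral_const_mul]
    congr 1
    have e1 := integral_comp_mul_left_Ioi (g n) 0 (b := (n : ℝ)⁻¹) (by positivity)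
    simp_rw [inv_mul_eq_div] at e1
    rw [e1, zero_div, inv_inv, smul_eq_mul, ← mul_assoc, inv_mul_cancel₀ hn0.ne', one_mul]
    simp only [hg]
    rw [setIntegral_indicator measurableSet_Ioo]
    congr 2
    ext x
    simp only [Set.mem_inter_iff, Set.mem_Ioo, Set.mem_Ioi]
    tauto
  have hform : ∀ᶠ n : ℕ in atTop, ∀ u, 0 < u → u / n < r → 0 < (n : ℝ) →
      m n * ((n : ℝ)⁻¹ * g n (u / n))
        = u ^ (-β - 1) * c⁻¹ * (L (1 / u * n) / L n) * (H n (u / n) / b n u ^ α) := by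
    filter_upwards [hscale] with n hs u hu hun hn
    obtain ⟨hb0, hLn, -, h4⟩ := hs u hu
    have hmem : u / n ∈ Set.Ioo 0 r := ⟨by positivity, hun⟩
    simp only [hg]
    rw [Set.indicator_of_mem hmem]
    have hbp : 0 < b n u ^ α := Real.rpow_pos_of_pos hb0 _
    calc _ = (m n * ((n : ℝ)⁻¹ * (b n u ^ α * (u / n) ^ (-ρ)))) * (H n (u / n) / b n u ^ α)
          * L (1 / (u / n)) := by field_simp
      _ = _ := by
        rw [h4, show 1 / (u / n) = 1 / u * n by field_simp]
        field_simp
  have hHle : ∀ (n : ℕ) u, 0 < u → 0 < (n : ℝ) → u / n < r → 0 < b n u →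
      H n (u / n) / b n u ^ α ≤ K * Θ * min 1 u := by
    intro n u hu hn hun hb0
    have hbp : 0 < b n u ^ α := Real.rpow_pos_of_pos hb0 _
    rw [div_le_iff₀' hbp]
    have := bernoulliExp_symbol_le hα hK0 hK θ (n := n) (p := u / n) (by positivity)
      (hun.le.trans hr1) (fun k => ⌊(n : ℝ) * t k⌋₊) hb0.le
    rwa [mul_div_cancel₀ _ hn.ne'] at this
  have hH0 : ∀ (n : ℕ) u, 0 < u → 0 < (n : ℝ) → u / n < r → 0 ≤ H n (u / n) := by
    intro n u hu hn hun
    have h5 : bernoulliExp n (u / n) (fun _ => 0) ≤ H n (u / n) :=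
      bernoulliExp_mono (by positivity) (hun.le.trans hr1) fun E _ => h0 _
    refine le_trans (le_of_eq ?_) h5
    simp [bernoulliExp]
  have hlim : Tendsto (fun n : ℕ => ∫ u in Set.Ioi 0, m n * ((n : ℝ)⁻¹ * g n (u / n))) atTop
      (𝓝 (∫ u in Set.Ioi 0, u ^ (-β - 1) * c⁻¹ * 1 *
        (D * ∫ ω, |weightSum θ (poissonOddSet (fun k => t k * u) ω)| ^ α ∂poissonLaw))) := by
    refine tendsto_integral_filter_of_dominated_convergence
      (fun u => c⁻¹ * (K * Θ) * Real.exp δ * (min 1 u * u ^ (-(β + δ) - 1)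
        + min 1 u * u ^ (-(β - δ) - 1))) ?_ ?_ ?_ ?_
    · refine Eventually.of_forall fun n => Measurable.aestronglyMeasurable ?_
      exact (((hgm n).comp (measurable_id.div_const _)).const_mul _).const_mul _
    · filter_upwards [hscale, hform, eventually_gt_atTop 0, eventually_ge_atTop ⌈x₀⌉₊]
        with n hs hf hn hnx
      have hn0 : (0 : ℝ) < n := by exact_mod_cast hn
      have hnx' : x₀ ≤ n := (Nat.le_ceil _).trans (by exact_mod_cast hnx)
      refine (ae_restrict_iff' measurableSet_Ioi).2 (Eventually.of_forall fun u hu => ?_)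
      have hu : 0 < u := hu
      have hmin : 0 ≤ min 1 u := by positivity
      by_cases hun : u / n < r
      · obtain ⟨hb0, hLn, -, -⟩ := hs u hu
        have h6 : x₀ ≤ 1 / u * n := by
          rw [hr, div_lt_div_iff₀ hn0 hx₀0, one_mul] at hun
          rw [one_div, ← div_eq_inv_mul, le_div_iff₀ hu]
          linarith
        have h7 := hP n (1 / u * n) hnx' h6
        have h8 : 1 / u * (n : ℝ) / n = u⁻¹ := by field_simp
        rw [h8, Real.inv_rpow hu.le, Real.inv_rpow hu.le, ← Real.rpow_neg hu.le,
          ← Real.rpow_neg hu.le, neg_neg] at h7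
        have h9 : 0 ≤ L (1 / u * n) / L n := (div_pos (hpos _ h6) hLn).le
        have hbp : 0 < b n u ^ α := Real.rpow_pos_of_pos hb0 _
        rw [hf u hu hun hn0, Real.norm_eq_abs, abs_of_nonneg (mul_nonneg (by positivity)
          (div_nonneg (hH0 n u hu hn0 hun) hbp.le))]
        calc _ ≤ u ^ (-β - 1) * c⁻¹ * (Real.exp δ * (u ^ (-δ) + u ^ δ)) * (K * Θ * min 1 u) := by
              have := hHle n u hu hn0 hun hb0
              have := div_nonneg (hH0 n u hu hn0 hun) hbp.le
              gcongr
          _ = _ := by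
            rw [show -(β + δ) - 1 = (-β - 1) + -δ by ring,
              show -(β - δ) - 1 = (-β - 1) + δ by ring, Real.rpow_add hu, Real.rpow_add hu]
            ring
      · have : g n (u / n) = 0 := Set.indicator_of_notMem (fun hmem => hun hmem.2) _
        rw [this]
        simp only [mul_zero, norm_zero]
        positivity
    · exact ((integrableOn_min_one_mul_rpow (by linarith) hδ2).add
        (integrableOn_min_one_mul_rpow (by linarith) (by linarith))).const_mul _
    · refine (ae_restrict_iff' measurableSet_Ioi).2 (Eventually.of_forall fun u hu => ?_)
      have hu : 0 < u := hu
      have hb0 : ∀ᶠ n in atTop, 0 < b n u := hscale.mono fun n hn => (hn u hu).1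
      -- The growth condition on `m` enters here: it pushes the argument of `h` to zero.
      have hbα : Tendsto (fun n => b n u ^ α) atTop (𝓝 0) := by
        have h1 := (hmn.inv_tendsto_atTop).const_mul (u ^ (-(α / α')) / c)
        rw [mul_zero] at h1
        refine h1.congr' ?_
        filter_upwards [hscale] with n hn
        exact (hn u hu).2.2.1.symm
      have hbt : Tendsto (fun n => b n u) atTop (𝓝 0) := by
        have h1 := hbα.rpow_const (p := α⁻¹) (Or.inr (by positivity))
        rw [Real.zero_rpow (by positivity)] at h1
        refine h1.congr' ?_
        filter_upwards [hb0] with n hn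
        exact Real.rpow_rpow_inv hn.le hα.ne'
      have h1 := (((hL.tendsto_div (1 / u) (by positivity)).comp
        tendsto_natCast_atTop_atTop).const_mul (u ^ (-β - 1) * c⁻¹)).mul
        (tendsto_bernoulliExp_symbol hα h00 hD ht θ hu hb0 hbt)
      refine h1.congr' ?_
      have hun : ∀ᶠ n : ℕ in atTop, u / n < r :=
        (tendsto_const_div_atTop_nhds_zero_nat u).eventually (gt_mem_nhds hr0)
      filter_upwards [hform, hun, eventually_gt_atTop 0] with n hf hun hn
      rw [hf u hu hun (by exact_mod_cast hn)]
      rfl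
  refine (hlim.congr' (hsub.mono fun n hn => hn.symm)).trans (le_of_eq ?_)
  rw [← integral_const_mul]
  congr 2
  ext u
  ring

lemma ae_parameterLaw (ρ : ℝ) (L : ℝ → ℝ) : ∀ᵐ x ∂(parameterLaw ρ L), x ∈ Set.Ioo (0 : ℝ) 1 :=
  (withDensity_absolutelyContinuous _ _).ae_le (ae_restrict_mem measurableSet_Ioo)

/-- On `(0, r)` one has `1 / x > 1`, where `L` is nonnegative, so `ENNReal.ofReal` does not truncate
the density. -/
lemma setIntegral_parameterLaw {ρ : ℝ} {L : ℝ → ℝ} (hL : Measurable L)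
    (hLn : ∀ x, 1 < x → 0 ≤ L x) {r : ℝ} (hr : r ≤ 1) (f : ℝ → ℝ) :
    ∫ x in Set.Ioo 0 r, f x ∂(parameterLaw ρ L)
      = ∫ x in Set.Ioo 0 r, f x * (x ^ (-ρ) * L (1 / x)) := by
  rw [parameterLaw, restrict_withDensity measurableSet_Ioo,
    Measure.restrict_restrict measurableSet_Ioo,
    Set.inter_eq_left.2 (Set.Ioo_subset_Ioo_right hr),
    integral_withDensity_eq_integral_toReal_smul (by fun_prop)
      (Eventually.of_forall fun x => ENNReal.ofReal_lt_top)]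
  refine setIntegral_congr_fun measurableSet_Ioo fun x hx => ?_
  have hx0 : 0 < x := hx.1
  have hx1 : 1 < 1 / x := (one_lt_div hx0).2 (hx.2.trans_le hr)
  simp only [smul_eq_mul]
  rw [ENNReal.toReal_ofReal (mul_nonneg (by positivity) (hLn _ hx1)), mul_comm]

/-- Convergence of the exponents of the characteristic functions. -/
lemma tendsto_mul_integral_bernoulliExp {ρ α' β c : ℝ} {L : ℝ → ℝ} (hL : IsSlowlyVarying L)
    (hLn : ∀ x, 1 < x → 0 ≤ L x) [IsProbabilityMeasure (parameterLaw ρ L)]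
    (hα : 0 < α) (hα' : 0 < α') (hβ : β = α / α' - 1 + ρ) (hβ0 : 0 < β) (hβ1 : β < 1)
    (hc : 0 < c) (hm : Measurable h) (h00 : h 0 = 0) (h0 : ∀ s, 0 ≤ h s) (hK0 : 0 ≤ K)
    (hK : ∀ s, h s ≤ K * |s| ^ α) {κ : ℝ} (hκ : ∀ s, h s ≤ κ)
    (hD : Tendsto (fun s => h s / |s| ^ α) (𝓝[≠] 0) (𝓝 D)) {m : ℕ → ℕ} (hm0 : ∀ n, 0 < m n)
    (hmn : Tendsto (fun n : ℕ => (m n : ℝ) * L n / (n : ℝ) ^ (1 - ρ)) atTop atTop)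
    {a : ℕ → ℝ}
    (ha : ∀ᶠ n : ℕ in atTop, 0 < a n ∧ a n ^ α = c * ((n : ℝ) ^ β * m n * L n))
    {t : ι → ℝ} (ht : ∀ k, t k ≤ 1) (θ : ι → ℝ) :
    Tendsto (fun n : ℕ => m n * ∫ x,
        bernoulliExp n x (fun E => h (1 / x ^ (1 / α') / a n *
          weightSum θ (oddSet (fun k => ⌊(n : ℝ) * t k⌋₊) E))) ∂(parameterLaw ρ L)) atTop
      (𝓝 (D / c * ∫ u in Set.Ioi 0,
        (∫ ω, |weightSum θ (poissonOddSet (fun k => t k * u) ω)| ^ α ∂poissonLaw)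
          * u ^ (-β - 1))) := by
  obtain ⟨r, hr0, hr1, hlim⟩ := tendsto_integral_small_parameters hL hα hβ hβ0 hβ1 hc hm h00
    h0 hK0 hK hD hm0 hmn ha ht θ
  set H : ℕ → ℝ → ℝ := fun n x => bernoulliExp n x (fun E => h (1 / x ^ (1 / α') / a n *
          weightSum θ (oddSet (fun k => ⌊(n : ℝ) * t k⌋₊) E))) with hH
  have hHm : ∀ n, Measurable (H n) := fun n => by
    refine Finset.measurable_sum _ fun E _ => Measurable.mul ?_ (hm.comp (by fun_prop))
    refine Finset.measurable_prod _ fun j _ => ?_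
    split_ifs <;> fun_prop
  have hH0 : ∀ n x, x ∈ Set.Ioo (0 : ℝ) 1 → 0 ≤ H n x := by
    intro n x hx
    have h5 : bernoulliExp n x (fun _ => 0) ≤ H n x :=
      bernoulliExp_mono hx.1.le hx.2.le fun E _ => h0 _
    refine le_trans (le_of_eq ?_) h5
    simp [bernoulliExp]
  have hHκ : ∀ n x, x ∈ Set.Ioo (0 : ℝ) 1 → H n x ≤ κ := by
    intro n x hx
    have h5 : H n x ≤ bernoulliExp n x (fun _ => κ * 1) :=
      bernoulliExp_mono hx.1.le hx.2.le fun E _ => (hκ _).trans (mul_one κ).ge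
    rwa [bernoulliExp_const_mul, bernoulliExp_one, mul_one] at h5
  have hint : ∀ n, Integrable (H n) (parameterLaw ρ L) := fun n => by
    refine Integrable.of_bound (C := κ) (hHm n).aestronglyMeasurable ?_
    filter_upwards [ae_parameterLaw ρ L] with x hx
    rw [Real.norm_eq_abs, abs_of_nonneg (hH0 n x hx)]
    exact hHκ n x hx
  have hsplit : ∀ n, m n * ∫ x, H n x ∂(parameterLaw ρ L)
      = m n * (∫ x in Set.Ioo 0 r, H n x * (x ^ (-ρ) * L (1 / x)))
        + m n * ∫ x in (Set.Ioo 0 r)ᶜ, H n x ∂(parameterLaw ρ L) := by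
    intro n
    rw [← setIntegral_parameterLaw hL.measurable hLn hr1, ← mul_add,
      integral_add_compl measurableSet_Ioo (hint n)]
  -- For `x ≥ r` the integrand is `O(a n ^ (-α))`, and `m n / a n ^ α` is `1 / (c n ^ β L n)`, which
  -- tends to zero.
  have hrest : Tendsto (fun n => m n * ∫ x in (Set.Ioo 0 r)ᶜ, H n x ∂(parameterLaw ρ L)) atTop
      (𝓝 0) := by
    set Θ := (∑ k, |θ k|) ^ α with hΘ
    have hΘ0 : 0 ≤ Θ := Real.rpow_nonneg (Finset.sum_nonneg fun _ _ => abs_nonneg _) _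
    have h1 := (((hL.tendsto_rpow_mul_atTop hβ0).comp
      tendsto_natCast_atTop_atTop).inv_tendsto_atTop).const_mul
      ((1 / r ^ (1 / α')) ^ α * (K * Θ) / c)
    rw [mul_zero] at h1
    refine squeeze_zero' (Eventually.of_forall fun n => ?_) ?_ h1
    · refine mul_nonneg (Nat.cast_nonneg _) (setIntegral_nonneg_of_ae_restrict ?_)
      filter_upwards [ae_restrict_of_ae (ae_parameterLaw ρ L)] with x hx
      exact hH0 n x hx
    · filter_upwards [ha, eventually_gt_atTop 0,
        tendsto_natCast_atTop_atTop.eventually hL.eventually_pos] with n ha hn hLn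
      have hn0 : (0 : ℝ) < n := by exact_mod_cast hn
      have hm0' : (0 : ℝ) < m n := by exact_mod_cast hm0 n
      have ha0 := ha.1
      set B := (1 / r ^ (1 / α')) ^ α / a n ^ α * (K * Θ) with hB
      have hB0 : 0 ≤ B := by positivity
      have h2 : ∫ x in (Set.Ioo 0 r)ᶜ, H n x ∂(parameterLaw ρ L) ≤ B := by
        have h3 : ∫ x in (Set.Ioo 0 r)ᶜ, H n x ∂(parameterLaw ρ L)
            ≤ ∫ x in (Set.Ioo 0 r)ᶜ, B ∂(parameterLaw ρ L) := by
          refine integral_mono_ae (hint n).integrableOn (integrable_const _) ?_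
          filter_upwards [ae_restrict_of_ae (ae_parameterLaw ρ L),
            ae_restrict_mem measurableSet_Ioo.compl] with x hx hxr
          have hrx : r ≤ x := by
            by_contra! hlt
            exact hxr ⟨hx.1, hlt⟩
          have hx0 : 0 < x := hx.1
          refine (bernoulliExp_symbol_le hα hK0 hK θ hx.1.le hx.2.le _ (by positivity)).trans ?_
          rw [Real.div_rpow (by positivity) ha0.le, hB]
          have h4 : min 1 (n * x) ≤ 1 := min_le_left _ _
          have h5 : 0 ≤ min 1 (n * x) := by positivity
          have h6 : K * Θ * min 1 (n * x) ≤ K * Θ :=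
            mul_le_of_le_one_right (by positivity) h4
          gcongr
        refine h3.trans ?_
        rw [setIntegral_const, smul_eq_mul]
        exact mul_le_of_le_one_left hB0 measureReal_le_one
      refine (mul_le_mul_of_nonneg_left h2 hm0'.le).trans (le_of_eq ?_)
      rw [hB, ha.2]
      simp only [Function.comp, Pi.inv_apply]
      field_simp
  have := hlim.add hrest
  rw [add_zero] at this
  exact this.congr fun n => (hsplit n).symm

end Limit

/-! ### Lévy's continuity theorem on `Fin d → ℝ`. -/

section Levy

variable {d : ℕ}

lemma charFun_map_toLp (μ : Measure (Fin d → ℝ)) (s : EuclideanSpace ℝ (Fin d)) :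
    charFun (μ.map (WithLp.toLp 2)) s
      = ∫ x, Complex.exp (Complex.I * ((∑ j, s j * x j : ℝ) : ℂ)) ∂μ := by
  rw [charFun_apply, integral_map (by fun_prop) (by fun_prop)]
  congr 1 with x
  rw [mul_comm]
  congr 3

/-- Characteristic functions are taken with respect to an inner product, while `Fin d → ℝ` carries
the sup norm; the measures are moved to `EuclideanSpace` and back. -/
lemma tendsto_probabilityMeasure_of_charFun {μ : ℕ → ProbabilityMeasure (Fin d → ℝ)}
    {ν : ProbabilityMeasure (Fin d → ℝ)}
    (h : ∀ θ : Fin d → ℝ, Tendsto (fun n => ∫ x, Complex.exp (Complex.I *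
      ((∑ j, θ j * x j : ℝ) : ℂ)) ∂(μ n : Measure (Fin d → ℝ))) atTop
      (𝓝 (∫ x, Complex.exp (Complex.I * ((∑ j, θ j * x j : ℝ) : ℂ)) ∂(ν : Measure (Fin d → ℝ))))) :
    Tendsto μ atTop (𝓝 ν) := by
  have hm : Measurable (WithLp.toLp 2 : (Fin d → ℝ) → EuclideanSpace ℝ (Fin d)) := by fun_prop
  have h1 : Tendsto (fun n => (μ n).map hm.aemeasurable) atTop (𝓝 (ν.map hm.aemeasurable)) := by
    refine ProbabilityMeasure.tendsto_of_tendsto_charFun fun s => ?_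
    simp only [ProbabilityMeasure.toMeasure_map, charFun_map_toLp]
    exact h s
  have hc : Continuous (WithLp.ofLp : EuclideanSpace ℝ (Fin d) → (Fin d → ℝ)) := by fun_prop
  have h2 := ProbabilityMeasure.tendsto_map_of_tendsto_of_continuous _ _ h1 hc
  have h3 : ∀ κ : ProbabilityMeasure (Fin d → ℝ),
      (κ.map hm.aemeasurable).map hc.aemeasurable = κ := by
    intro κ
    refine Subtype.ext ?_
    change Measure.map WithLp.ofLp (Measure.map (WithLp.toLp 2) (κ : Measure (Fin d → ℝ))) = _
    rw [Measure.map_map hc.measurable hm]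
    exact Measure.map_id
  simpa only [h3] using h2

/-- Lévy's continuity theorem, with existence of the limit. -/
lemma exists_tendsto_probabilityMeasure_of_charFun {μ : ℕ → ProbabilityMeasure (Fin d → ℝ)}
    {Φ : (Fin d → ℝ) → ℂ} (hΦ : ContinuousAt Φ 0)
    (h : ∀ θ : Fin d → ℝ, Tendsto (fun n => ∫ x, Complex.exp (Complex.I *
      ((∑ j, θ j * x j : ℝ) : ℂ)) ∂(μ n : Measure (Fin d → ℝ))) atTop (𝓝 (Φ θ))) :
    ∃ ν : ProbabilityMeasure (Fin d → ℝ),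
      (∀ θ, ∫ x, Complex.exp (Complex.I * ((∑ j, θ j * x j : ℝ) : ℂ)) ∂(ν : Measure (Fin d → ℝ))
        = Φ θ) ∧ Tendsto μ atTop (𝓝 ν) := by
  have hm : Measurable (WithLp.toLp 2 : (Fin d → ℝ) → EuclideanSpace ℝ (Fin d)) := by fun_prop
  set μ' : ℕ → ProbabilityMeasure (EuclideanSpace ℝ (Fin d)) :=
    fun n => (μ n).map hm.aemeasurable with hμ'
  have hchar : ∀ s : EuclideanSpace ℝ (Fin d),
      Tendsto (fun n => charFun (μ' n : Measure (EuclideanSpace ℝ (Fin d))) s) atTop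
        (𝓝 (Φ (WithLp.ofLp s))) := by
    intro s
    simp only [hμ', ProbabilityMeasure.toMeasure_map, charFun_map_toLp]
    exact h s
  have hcont : ContinuousAt (fun s : EuclideanSpace ℝ (Fin d) => Φ (WithLp.ofLp s)) 0 :=
    ContinuousAt.comp (g := Φ) (f := fun s : EuclideanSpace ℝ (Fin d) => WithLp.ofLp s)
      (by simpa using hΦ) (by fun_prop)
  -- Continuity of `Φ` at 0 gives tightness, hence a subsequential limit. Its characteristic
  -- function must be `Φ`, and then the whole sequence converges to it.
  have htight := isTightMeasureSet_of_tendsto_charFun hcont hchar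
  have hcomp : IsCompact (closure (Set.range μ')) := by
    refine isCompact_closure_of_isTightMeasureSet (htight.subset ?_)
    rintro _ ⟨_, ⟨n, rfl⟩, rfl⟩
    exact ⟨n, rfl⟩
  obtain ⟨ν', -, φ, hφ, hlim⟩ := hcomp.isSeqCompact fun n => subset_closure (Set.mem_range_self n)
  have hν' : ∀ s, charFun (ν' : Measure (EuclideanSpace ℝ (Fin d))) s = Φ (WithLp.ofLp s) :=
    fun s => tendsto_nhds_unique (ProbabilityMeasure.tendsto_iff_tendsto_charFun.1 hlim s)
      ((hchar s).comp hφ.tendsto_atTop)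
  have hm' : Measurable (WithLp.ofLp : EuclideanSpace ℝ (Fin d) → (Fin d → ℝ)) := by fun_prop
  have hν : ∀ θ : Fin d → ℝ, ∫ x, Complex.exp (Complex.I * ((∑ j, θ j * x j : ℝ) : ℂ))
      ∂((ν'.map hm'.aemeasurable : ProbabilityMeasure (Fin d → ℝ)) : Measure (Fin d → ℝ))
        = Φ θ := by
    intro θ
    have h1 := charFun_map_toLp
      ((ν'.map hm'.aemeasurable : ProbabilityMeasure (Fin d → ℝ)) : Measure (Fin d → ℝ))
      (WithLp.toLp 2 θ)
    simp only at h1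
    rw [← h1, ProbabilityMeasure.toMeasure_map, Measure.map_map hm hm']
    have h2 : (WithLp.toLp 2 ∘ WithLp.ofLp : EuclideanSpace ℝ (Fin d) → _) = id := rfl
    rw [h2, Measure.map_id]
    exact hν' _
  refine ⟨_, hν, tendsto_probabilityMeasure_of_charFun fun θ => ?_⟩
  rw [hν θ]
  exact h θ

end Levy

/-! ### The limiting exponent and its continuity at zero. -/

/-- If `m n * x n → Λ` and `m n → ∞` then `(1 - x n) ^ m n → exp (-Λ)`. -/
lemma tendsto_one_sub_pow_exp {m : ℕ → ℕ} {x : ℕ → ℝ} {Λ : ℝ}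
    (hm : Tendsto (fun n => (m n : ℝ)) atTop atTop)
    (hx : Tendsto (fun n => (m n : ℝ) * x n) atTop (𝓝 Λ)) :
    Tendsto (fun n => (1 - x n) ^ m n) atTop (𝓝 (Real.exp (-Λ))) := by
  have hx0 : Tendsto x atTop (𝓝 0) := by
    refine (hx.div_atTop hm).congr' ?_
    filter_upwards [hm.eventually_gt_atTop 0] with n hn
    rw [mul_div_cancel_left₀ _ hn.ne']
  have h1 : Tendsto (fun n => -((m n : ℝ) * x n) * (1 - x n)⁻¹) atTop (𝓝 (-Λ)) := by
    have := hx.neg.mul ((hx0.const_sub 1).inv₀ (by norm_num))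
    simpa using this
  have hx1 : ∀ᶠ n in atTop, x n < 1 := hx0.eventually (gt_mem_nhds one_pos)
  -- Squeeze between `-x / (1 - x) ≤ log (1 - x) ≤ -x`.
  have h2 : Tendsto (fun n => (m n : ℝ) * Real.log (1 - x n)) atTop (𝓝 (-Λ)) := by
    refine tendsto_of_tendsto_of_tendsto_of_le_of_le' h1 hx.neg ?_ ?_
    · filter_upwards [hx1] with n hn
      have hp : 0 < 1 - x n := sub_pos.2 hn
      have := mul_le_mul_of_nonneg_left (Real.one_sub_inv_le_log_of_pos hp)
        (Nat.cast_nonneg (α := ℝ) (m n))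
      refine (le_of_eq ?_).trans this
      field_simp
      ring
    · filter_upwards [hx1] with n hn
      have := mul_le_mul_of_nonneg_left (Real.log_le_sub_one_of_pos (sub_pos.2 hn))
        (Nat.cast_nonneg (α := ℝ) (m n))
      linarith
  refine h2.rexp.congr' ?_
  filter_upwards [hx1] with n hn
  rw [mul_comm, Real.exp_mul, Real.exp_log (sub_pos.2 hn), Real.rpow_natCast]

lemma karlinExponent_eq (α β : ℝ) {d : ℕ} (t : Fin d → ℝ≥0) (θ : Fin d → ℝ) :
    karlinExponent α β t θ = β / (Real.Gamma (1 - β) * stableConst α) *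
      ∫ u in Set.Ioi (0 : ℝ), (∫ ω, |weightSum θ (poissonOddSet (fun k => (t k : ℝ) * u) ω)| ^ α
        ∂poissonLaw) * u ^ (-β - 1) := by
  simp [karlinExponent, weightSum, poissonOddSet]

/-- Integrating the bound `(∑ k, |θ k|) ^ α * min 1 u` against `u ^ (-β - 1)`. It forces the
exponent to vanish as `θ → 0`, which is all that tightness requires. -/
lemma abs_karlinExponent_le {α β : ℝ} (hα : 0 < α) (hβ0 : 0 < β) (hβ1 : β < 1) {d : ℕ}
    {t : Fin d → ℝ≥0} (ht : ∀ j, t j ≤ 1) (θ : Fin d → ℝ) :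
    |karlinExponent α β t θ| ≤ |β / (Real.Gamma (1 - β) * stableConst α)| *
      ((∑ k, |θ k|) ^ α * ∫ u in Set.Ioi (0 : ℝ), min 1 u * u ^ (-β - 1)) := by
  have h0 : ∀ u : ℝ, 0 ≤ ∫ ω, |weightSum θ (poissonOddSet (fun k => (t k : ℝ) * u) ω)| ^ α
      ∂poissonLaw := fun u => integral_nonneg fun ω => by positivity
  have hI : 0 ≤ ∫ u in Set.Ioi (0 : ℝ), (∫ ω, |weightSum θ
      (poissonOddSet (fun k => (t k : ℝ) * u) ω)| ^ α ∂poissonLaw) * u ^ (-β - 1) :=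
    setIntegral_nonneg measurableSet_Ioi
      fun u hu => mul_nonneg (h0 u) (Real.rpow_nonneg (le_of_lt hu) _)
  rw [karlinExponent_eq, abs_mul, abs_of_nonneg hI, ← integral_const_mul ((∑ k, |θ k|) ^ α)]
  refine mul_le_mul_of_nonneg_left ?_ (abs_nonneg _)
  refine integral_mono_of_nonneg ?_
    ((integrableOn_min_one_mul_rpow hβ0 hβ1).const_mul _) ?_
  · filter_upwards [ae_restrict_mem measurableSet_Ioi] with u hu
    exact mul_nonneg (h0 u) (Real.rpow_nonneg (le_of_lt hu) _)
  · filter_upwards [ae_restrict_mem measurableSet_Ioi] with u hu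
    have hu : 0 < u := hu
    have := integral_abs_weightSum_rpow_le hα (t := fun k => (t k : ℝ))
      (fun k => by exact_mod_cast ht k) θ hu
    rw [← mul_assoc]
    gcongr

lemma continuousAt_exp_neg_karlinExponent {α β : ℝ} (hα : 0 < α) (hβ0 : 0 < β) (hβ1 : β < 1)
    {d : ℕ} {t : Fin d → ℝ≥0} (ht : ∀ j, t j ≤ 1) :
    ContinuousAt (fun θ : Fin d → ℝ => ((Real.exp (-karlinExponent α β t θ) : ℝ) : ℂ)) 0 := by
  have hb := abs_karlinExponent_le hα hβ0 hβ1 ht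
  set c₁ := |β / (Real.Gamma (1 - β) * stableConst α)|
  set c₂ := ∫ u in Set.Ioi (0 : ℝ), min 1 u * u ^ (-β - 1)
  have h1 : Continuous fun θ : Fin d → ℝ => c₁ * ((∑ k, |θ k|) ^ α * c₂) := by
    have : Continuous fun θ : Fin d → ℝ => (∑ k, |θ k|) ^ α :=
      Continuous.rpow_const (by fun_prop) fun _ => Or.inr hα.le
    fun_prop
  have h2 := h1.tendsto 0
  simp only [Pi.zero_apply, abs_zero, Finset.sum_const_zero, Real.zero_rpow hα.ne', zero_mul,
    mul_zero] at h2
  have h3 : karlinExponent α β t (0 : Fin d → ℝ) = 0 := by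
    have := hb 0
    simp only [Pi.zero_apply, abs_zero, Finset.sum_const_zero, Real.zero_rpow hα.ne', zero_mul,
      mul_zero] at this
    exact abs_nonpos_iff.1 this
  have h4 : ContinuousAt (fun θ : Fin d → ℝ => karlinExponent α β t θ) 0 := by
    rw [ContinuousAt, h3]
    exact squeeze_zero_norm hb h2
  fun_prop

/-! ### Independent copies and the proof of the theorem. -/

section Copies

lemma measurable_modelVar {Ω : Type*} [MeasurableSpace Ω] (α' : ℝ) {X q : Ω → ℝ} {η : ℕ → Ω → ℕ}
    (hX : Measurable X) (hq : Measurable q) (hη : ∀ j, Measurable (η j)) (j : ℕ) :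
    Measurable (modelVar α' X q η j) := by
  have hw' : Measurable fun w => (η j w : ℝ) :=
    (measurable_from_top (f := fun k : ℕ => (k : ℝ))).comp (hη j)
  have hp : Measurable fun w => (-1 : ℝ) ^ (∑ i ∈ Finset.range (j + 1), η i w) :=
    (measurable_from_top (f := fun k : ℕ => (-1 : ℝ) ^ k)).comp
      (Finset.measurable_sum _ fun i _ => hη i)
  exact ((hX.div (hq.pow_const _)).mul hp).mul hw'

/-- The model variable as a function of the triple `(x, q, e)`. -/
noncomputable def canonicalVar (α' : ℝ) (j : ℕ) (p : ℝ × ℝ × (ℕ → ℕ)) : ℝ :=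
  modelVar α' (fun p : ℝ × ℝ × (ℕ → ℕ) => p.1) (fun p => p.2.1) (fun j p => p.2.2 j) j p

lemma measurable_canonicalVar (α' : ℝ) (j : ℕ) : Measurable (canonicalVar α' j) :=
  measurable_modelVar α' (by fun_prop) (by fun_prop) (fun j => by fun_prop) j

variable {Ω₀ : Type*} [MeasurableSpace Ω₀] {P₀ : Measure Ω₀}
  {X₀ q₀ : Ω₀ → ℝ} {η₀ : ℕ → Ω₀ → ℕ}
  {Ω : Type*} [MeasurableSpace Ω] {P : Measure Ω}
  {X q : ℕ → Ω → ℝ} {η : ℕ → ℕ → Ω → ℕ}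

lemma aemeasurable_aggregatedSum
    (hident : ∀ i, IdentDistrib (fun ω => (X i ω, q i ω, fun j => η i j ω))
      (fun ω => (X₀ ω, q₀ ω, fun j => η₀ j ω)) P P₀) (α' : ℝ) (M n : ℕ) (t : ℝ≥0) :
    AEMeasurable (aggregatedSum α' X q η M n t) P := by
  have h : ∀ i j, AEMeasurable (modelVar α' (X i) (q i) (η i) j) P := fun i j =>
    (measurable_canonicalVar α' j).comp_aemeasurable (hident i).aemeasurable_fst
  exact Finset.aemeasurable_fun_sum _ fun j _ => Finset.aemeasurable_fun_sum _ fun i _ => h i j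

/-- The characteristic function of the aggregated sums is a power of that of one copy. -/
lemma integral_cexp_aggregatedSum
    (hindep : iIndepFun (fun i ω => (X i ω, q i ω, fun j => η i j ω)) P)
    (hident : ∀ i, IdentDistrib (fun ω => (X i ω, q i ω, fun j => η i j ω))
      (fun ω => (X₀ ω, q₀ ω, fun j => η₀ j ω)) P P₀) (α' a : ℝ) (M n : ℕ) {d : ℕ}
    (t : Fin d → ℝ≥0) (θ : Fin d → ℝ) :
    ∫ ω, Complex.exp (Complex.I *
        ((∑ k, θ k * (aggregatedSum α' X q η M n (t k) ω / a) : ℝ) : ℂ)) ∂P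
      = (∫ ω, Complex.exp (Complex.I * ((∑ k, θ k * ((∑ j ∈ Finset.range ⌊(n : ℝ≥0) * t k⌋₊,
          modelVar α' X₀ q₀ η₀ j ω) / a) : ℝ) : ℂ)) ∂P₀) ^ M := by
  set f : ℝ × ℝ × (ℕ → ℕ) → ℂ := fun p => Complex.exp (Complex.I *
    ((∑ k, θ k * ((∑ j ∈ Finset.range ⌊(n : ℝ≥0) * t k⌋₊, canonicalVar α' j p) / a) : ℝ) : ℂ))
    with hf
  have hfm : Measurable f := by
    have h1 : Measurable fun p => ∑ k, θ k *
        ((∑ j ∈ Finset.range ⌊(n : ℝ≥0) * t k⌋₊, canonicalVar α' j p) / a) :=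
      Finset.measurable_sum _ fun k _ => ((Finset.measurable_sum _ fun j _ =>
        measurable_canonicalVar α' j).div_const _).const_mul _
    fun_prop
  have h1 : ∀ ω, Complex.exp (Complex.I *
        ((∑ k, θ k * (aggregatedSum α' X q η M n (t k) ω / a) : ℝ) : ℂ))
      = ∏ i : Fin M, f (X i ω, q i ω, fun j => η i j ω) := by
    intro ω
    simp only [hf]
    rw [← Complex.exp_sum, ← Finset.mul_sum, ← Complex.ofReal_sum]
    congr 3
    rw [Finset.sum_comm]
    refine Finset.sum_congr rfl fun k _ => ?_
    rw [← Finset.mul_sum, ← Finset.sum_div, aggregatedSum, Finset.sum_comm, Finset.sum_range]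
    rfl
  simp_rw [h1]
  have hind : iIndepFun (fun (i : Fin M) ω => (X i ω, q i ω, fun j => η i j ω)) P :=
    hindep.precomp Fin.val_injective
  rw [hind.integral_fun_prod_comp (f := fun _ => f) (fun i => (hident i).aemeasurable_fst)
    fun i => hfm.aestronglyMeasurable]
  have h2 : ∀ i : Fin M, ∫ ω, f (X i ω, q i ω, fun j => η i j ω) ∂P
      = ∫ ω, f (X₀ ω, q₀ ω, fun j => η₀ j ω) ∂P₀ := fun i => ((hident i).comp hfm).integral_eq
  simp_rw [h2]
  rw [Finset.prod_const, Finset.card_univ, Fintype.card_fin]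
  rfl

end Copies

/-- As `ρ < 1`, the factor `L n / n ^ (1 - ρ)` tends to zero through positive values, so the product
can diverge only if `m n` does. -/
lemma tendsto_natCast_of_tendsto_mul_slowlyVarying {ρ : ℝ} (hρ : ρ < 1) {L : ℝ → ℝ}
    (hL : IsSlowlyVarying L) {m : ℕ → ℕ}
    (hm : Tendsto (fun n : ℕ => (m n : ℝ) * L n / (n : ℝ) ^ (1 - ρ)) atTop atTop) :
    Tendsto (fun n => (m n : ℝ)) atTop atTop := by
  have h1 : Tendsto (fun n : ℕ => L n / (n : ℝ) ^ (1 - ρ)) atTop (𝓝[>] 0) := by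
    refine tendsto_nhdsWithin_iff.2 ⟨(hL.tendsto_div_rpow_zero (sub_pos.2 hρ)).comp
      tendsto_natCast_atTop_atTop, ?_⟩
    filter_upwards [eventually_gt_atTop 0,
      tendsto_natCast_atTop_atTop.eventually hL.eventually_pos] with n hn hLn
    have hn0 : (0 : ℝ) < n := by exact_mod_cast hn
    exact div_pos hLn (by positivity)
  refine (hm.atTop_mul_atTop₀ (tendsto_inv_nhdsGT_zero.comp h1)).congr' ?_
  filter_upwards [h1.eventually self_mem_nhdsWithin] with n hn
  have hn : 0 < L n / (n : ℝ) ^ (1 - ρ) := hn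
  simp only [Function.comp]
  rw [mul_div_assoc, mul_assoc, mul_inv_cancel₀ hn.ne', mul_one]

lemma normalization_spec {α β C : ℝ} (hα : 0 < α) (hβ0 : 0 < β) (hβ1 : β < 1) (hC : 0 < C)
    {L : ℝ → ℝ} (hL : IsSlowlyVarying L) {m : ℕ → ℕ} (hm_pos : ∀ n, 0 < m n) :
    ∀ᶠ n : ℕ in atTop, 0 < normalization α β C L (m n) n ∧
      normalization α β C L (m n) n ^ α
        = C * (Real.Gamma (1 - β) / β) * ((n : ℝ) ^ β * m n * L n) := by
  filter_upwards [eventually_gt_atTop 0,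
    tendsto_natCast_atTop_atTop.eventually hL.eventually_pos] with n hn hLn
  have hn0 : (0 : ℝ) < n := by exact_mod_cast hn
  have hm0 : (0 : ℝ) < m n := by exact_mod_cast hm_pos n
  have hΓ : 0 < Real.Gamma (1 - β) := Real.Gamma_pos_of_pos (by linarith)
  have hpos : 0 < C * (Real.Gamma (1 - β) / β) * ((n : ℝ) ^ β * m n * L n) := by positivity
  refine ⟨Real.rpow_pos_of_pos hpos _, ?_⟩
  rw [normalization, ← Real.rpow_mul hpos.le, one_div_mul_cancel hα.ne', Real.rpow_one]

/-- Convergence of the characteristic functions of the finite-dimensional distributions. -/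
lemma tendsto_integral_cexp_aggregatedSum
    {Ω₀ : Type*} [MeasurableSpace Ω₀] {P₀ : Measure Ω₀} [IsProbabilityMeasure P₀]
    {X₀ q₀ : Ω₀ → ℝ} {η₀ : ℕ → Ω₀ → ℕ}
    {ρ : ℝ} (hρ : ρ < 1) {L : ℝ → ℝ} (hL : IsSlowlyVarying L) (hL_nonneg : ∀ x, 1 < x → 0 ≤ L x)
    (hmodel : IsBaseModel ρ L X₀ q₀ η₀ P₀)
    {α C : ℝ} (htail : TailCondition α C X₀ P₀)
    {α' : ℝ} (hα' : 0 < α') {β : ℝ} (hβ : β = α / α' - 1 + ρ) (hβ0 : 0 < β) (hβ1 : β < 1)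
    {Ω : Type*} [MeasurableSpace Ω] {P : Measure Ω}
    {X q : ℕ → Ω → ℝ} {η : ℕ → ℕ → Ω → ℕ}
    (hindep : iIndepFun (fun i ω => (X i ω, q i ω, fun j => η i j ω)) P)
    (hident : ∀ i, IdentDistrib (fun ω => (X i ω, q i ω, fun j => η i j ω))
      (fun ω => (X₀ ω, q₀ ω, fun j => η₀ j ω)) P P₀)
    {m : ℕ → ℕ} (hm_pos : ∀ n, 0 < m n)
    (hm : Tendsto (fun n : ℕ => (m n : ℝ) * L n / (n : ℝ) ^ (1 - ρ)) atTop atTop)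
    {d : ℕ} {t : Fin d → ℝ≥0} (ht : ∀ j, t j ≤ 1) (θ : Fin d → ℝ) :
    Tendsto (fun n : ℕ => ∫ ω, Complex.exp (Complex.I * ((∑ k, θ k *
        (aggregatedSum α' X q η (m n) n (t k) ω / normalization α β C L (m n) n) : ℝ) : ℂ)) ∂P)
      atTop (𝓝 ((Real.exp (-karlinExponent α β t θ) : ℝ) : ℂ)) := by
  have hα := htail.pos
  have hC := htail.const_pos
  have hX := hmodel.measurable_X
  have hΓ : 0 < Real.Gamma (1 - β) := Real.Gamma_pos_of_pos (by linarith)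
  have : IsProbabilityMeasure (parameterLaw ρ L) := by
    rw [← hmodel.law_q]
    exact Measure.isProbabilityMeasure_map hmodel.measurable_q.aemeasurable
  obtain ⟨K, hK0, hK⟩ := htail.exists_symbol_le hX
  have hmain := tendsto_mul_integral_bernoulliExp
    (h := fun s => ∫ ω, (1 - Real.cos (s * X₀ ω)) ∂P₀) (c := C * (Real.Gamma (1 - β) / β))
    (a := fun n => normalization α β C L (m n) n) (t := fun k => (t k : ℝ))
    hL hL_nonneg hα hα' hβ hβ0 hβ1 (by positivity) (measurable_integral_one_sub_cos hX)
    (by simp) integral_one_sub_cos_nonneg hK0 hK integral_one_sub_cos_le_two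
    (htail.tendsto_symbol hX) hm_pos hm (normalization_spec hα hβ0 hβ1 hC hL hm_pos)
    (fun k => by exact_mod_cast ht k) θ
  -- The constant in the normalization is designed for this: `C` cancels and the Karlin prefactor
  -- remains.
  have hconst : C * (stableConst α)⁻¹ / (C * (Real.Gamma (1 - β) / β))
      = β / (Real.Gamma (1 - β) * stableConst α) := by
    rw [div_eq_mul_inv β, mul_inv (Real.Gamma (1 - β))]
    field_simp
  rw [hconst, ← karlinExponent_eq] at hmain
  have hpow := tendsto_one_sub_pow_exp
    (tendsto_natCast_of_tendsto_mul_slowlyVarying hρ hL hm) hmain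
  refine ((Complex.continuous_ofReal.tendsto _).comp hpow).congr fun n => ?_
  have hfloor : ∀ k, ⌊(n : ℝ≥0) * t k⌋₊ = ⌊(n : ℝ) * (t k : ℝ)⌋₊ := fun k => by
    rw [← NNReal.coe_natCast, ← NNReal.coe_mul]
    rfl
  rw [integral_cexp_aggregatedSum hindep hident]
  simp_rw [hfloor]
  rw [hmodel.integral_cexp α' _ θ n _ fun k => Nat.floor_le_of_le
    (mul_le_of_le_one_right (Nat.cast_nonneg n) (by exact_mod_cast ht k))]
  simp only [Function.comp]
  rw [Complex.ofReal_pow]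
  rfl

theorem theorem1
    -- the generic triple `(𝒳, q, (η_j)_j)`
    {Ω₀ : Type*} [MeasurableSpace Ω₀] (P₀ : Measure Ω₀) [IsProbabilityMeasure P₀]
    (X₀ q₀ : Ω₀ → ℝ) (η₀ : ℕ → Ω₀ → ℕ)
    (ρ : ℝ) (hρ : ρ < 1) (L : ℝ → ℝ) (hL : IsSlowlyVarying L) (hL_nonneg : ∀ x, 1 < x → 0 ≤ L x)
    (hmodel : IsBaseModel ρ L X₀ q₀ η₀ P₀)
    (α C : ℝ) (htail : TailCondition α C X₀ P₀)
    (α' : ℝ) (hα' : 0 < α') (β : ℝ) (hβ : β = α / α' - 1 + ρ) (hβ0 : 0 < β) (hβ1 : β < 1)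
    -- i.i.d. copies of the generic triple
    {Ω : Type*} [MeasurableSpace Ω] (P : Measure Ω) [IsProbabilityMeasure P]
    (X q : ℕ → Ω → ℝ) (η : ℕ → ℕ → Ω → ℕ)
    (hindep : iIndepFun (fun i ω => (X i ω, q i ω, fun j => η i j ω)) P)
    (hident : ∀ i, IdentDistrib (fun ω => (X i ω, q i ω, fun j => η i j ω))
      (fun ω => (X₀ ω, q₀ ω, fun j => η₀ j ω)) P P₀)
    -- the numbers of aggregated copies
    (m : ℕ → ℕ) (hm_pos : ∀ n, 0 < m n) (hm_mono : Monotone m)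
    (hm : Tendsto (fun n : ℕ => (m n : ℝ) * L n / (n : ℝ) ^ (1 - ρ)) atTop atTop) :
    -- the Karlin finite-dimensional distributions exist and are the limits
    (∀ (d : ℕ) (t : Fin d → ℝ≥0), (∀ j, t j ≤ 1) →
      ∃ (ν : Measure (Fin d → ℝ)) (_ : IsProbabilityMeasure ν), IsKarlinFdd α β t ν ∧
        TendstoInDistribution
          (fun (n : ℕ) ω j => aggregatedSum α' X q η (m n) n (t j) ω / normalization α β C L (m n) n)
          atTop id (fun _ => P) ν) ∧
    -- convergence of the finite-dimensional distributions to those of a Karlin stable process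
    (∀ {Ω' : Type*} [MeasurableSpace Ω'] (P' : Measure Ω') [IsProbabilityMeasure P']
      (ζ : ℝ≥0 → Ω' → ℝ), IsKarlinStableProcess α β ζ P' →
      ∀ (d : ℕ) (t : Fin d → ℝ≥0), (∀ j, t j ≤ 1) →
        TendstoInDistribution
          (fun (n : ℕ) ω j => aggregatedSum α' X q η (m n) n (t j) ω / normalization α β C L (m n) n)
          atTop (fun ω j => ζ (t j) ω) (fun _ => P) P') := by
  have hα := htail.pos
  have haem : ∀ (d : ℕ) (t : Fin d → ℝ≥0) (n : ℕ), AEMeasurable (fun ω j =>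
      aggregatedSum α' X q η (m n) n (t j) ω / normalization α β C L (m n) n) P := fun d t n =>
    aemeasurable_pi_lambda _ fun j =>
      (aemeasurable_aggregatedSum hident α' (m n) n (t j)).div_const _
  have hlim : ∀ (d : ℕ) (t : Fin d → ℝ≥0), (∀ j, t j ≤ 1) → ∀ θ : Fin d → ℝ,
      Tendsto (fun n => ∫ x, Complex.exp (Complex.I * ((∑ j, θ j * x j : ℝ) : ℂ))
        ∂(P.map (fun ω j => aggregatedSum α' X q η (m n) n (t j) ω /
          normalization α β C L (m n) n))) atTop
        (𝓝 ((Real.exp (-karlinExponent α β t θ) : ℝ) : ℂ)) := by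
    intro d t ht θ
    refine (tendsto_integral_cexp_aggregatedSum hρ hL hL_nonneg hmodel htail hα' hβ hβ0 hβ1
      hindep hident hm_pos hm ht θ).congr fun n => ?_
    rw [integral_map (haem d t n) (Continuous.aestronglyMeasurable (by fun_prop))]
  refine ⟨fun d t ht => ?_, fun P' _ ζ hζ d t ht => ?_⟩
  · obtain ⟨ν, hν, hconv⟩ := exists_tendsto_probabilityMeasure_of_charFun
      (μ := fun n => ⟨P.map (fun ω j => aggregatedSum α' X q η (m n) n (t j) ω /
        normalization α β C L (m n) n), Measure.isProbabilityMeasure_map (haem d t n)⟩)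
      (continuousAt_exp_neg_karlinExponent hα hβ0 hβ1 ht) (hlim d t ht)
    refine ⟨ν, inferInstance, hν, haem d t, aemeasurable_id, ?_⟩
    simp only [Measure.map_id]
    exact hconv
  · have hζm : AEMeasurable (fun ω j => ζ (t j) ω) P' :=
      aemeasurable_pi_lambda _ fun j => hζ.aemeasurable (t j)
    refine ⟨haem d t, hζm, tendsto_probabilityMeasure_of_charFun fun θ => ?_⟩
    have h1 := hlim d t ht θ
    rw [← hζ.fdd d t θ] at h1
    exact h1
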